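/- Let $[m]=\{1,\dots,m\}$ and let $\binom{[n]}{k}$ be the family of all $k$-element subsets of $[n]$. Put $$\mathcal F_s^t(n,k)=\Big\{F\in\tbinom{[n]}{k}: |F\cap[t+2s]|\ge t+s\Big\}.$$ Families $\mathcal A,\mathcal B\subset\binom{[n]}{k}$ are cross $t$-intersecting if $|A\cap B|\ge t$ for all $A\in\mathcal A$, $B\in\mathcal B$. A family $\mathcal A\subset\binom{[n]}{k}$ is shifted if, whenever $1\le i<j\le n$, $A\in\mathcal A$ and $A\cap\{i,j\}=\{j\}$, also $(A\setminus\{j\})\cup\{i\}\in\mathcal A$. **Proposition.** For every integer $t\ge 14$ there is a constant $\gamma^*\in(0,1]$, depending only on $t$, such that the following holds for all integers $k\ge t$ and $n\ge (t+1)k$, all real $\eta\in(0,1]$, and all shifted cross $t$-intersecting families $\mathcal A,\mathcal B\subset\binom{[n]}{k}$. At least one of the following holds: 1. $\sqrt{|\mathcal A||\mathcal B|}<(1-\gamma^*\eta)\binom{n-t}{k-t}$; 2. for some $s\in\{0,1\}$, $\;|\mathcal A\bigtriangleup\mathcal F_s^t(n,k)|+|\mathcal B\bigtriangleup\mathcal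 F_s^t(n,k)|<\eta\,|\mathcal F_s^t(n,k)|$. Moreover, for each $s\in\{0,1\}$ for which the inequality in 2 holds, $\sqrt{|\mathcal A||\mathcal B|}\le|\mathcal F_s^t(n,k)|$, with equality if and only if $\mathcal A=\mathcal B=\mathcal F_s^t(n,k)$. -/

import Mathlib

/-- The family of all `k`-element subsets of `[n] = {1, …, n}`. -/
def uniformSets (n k : ℕ) : Finset (Finset ℕ) :=
  (Finset.Icc 1 n).powersetCard k

/-- The family of all `k`-element subsets `F` of `[n]` with `|F ∩ [t + 2 i]| ≥ t + i`. -/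
def frankl (t i n k : ℕ) : Finset (Finset ℕ) :=
  (uniformSets n k).filter fun F => t + i ≤ (F ∩ Finset.Icc 1 (t + 2 * i)).card

/-- Every member of `A` meets every member of `B` in at least `t` elements. -/
def CrossIntersecting (t : ℕ) (A B : Finset (Finset ℕ)) : Prop :=
  ∀ F ∈ A, ∀ G ∈ B, t ≤ (F ∩ G).card

/-- A family of subsets of `[n]` is shifted if replacing an element of a member by a smaller
element of `[n]` not in that member always gives a member of the family. -/
def IsShifted (n : ℕ) (A : Finset (Finset ℕ)) : Prop :=
  ∀ i j : ℕ, 1 ≤ i → i < j → j ≤ n → ∀ F ∈ A, F ∩ {i, j} = {j} → (F \ {j}) ∪ {i} ∈ A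

/-- `|A ∆ F| + |B ∆ F| < η |F|`, where `F` is the family of all `k`-element subsets of `[n]`
that meet `[t + 2 s]` in at least `t + s` elements. -/
def CloseToFrankl (t s n k : ℕ) (η : ℝ) (A B : Finset (Finset ℕ)) : Prop :=
  ((symmDiff A (frankl t s n k)).card : ℝ) + ((symmDiff B (frankl t s n k)).card : ℝ)
    < η * ((frankl t s n k).card : ℝ)

/-!
A `k`-element subset `F` of `[n]` is read as a walk that steps up at the times in `F` and down at
the other times; `pre F m` counts the up-steps among the first `m` steps, so that the level at time
`m` is `2 * pre F m - m`. Members `F`, `G` of two cross `t`-intersecting families, one of them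
shifted, satisfy `m + t ≤ pre F m + pre G m` for some time `m` (`exists_pre_add_pre_ge`), that is,
their levels at some common time sum to at least `2 * t`. This is the only consequence of the
hypotheses that is used afterwards.

Let `u` and `v` be the smallest heights (maximal levels) of the members of `A` and of `B`; then
`u + v ≥ 2 * t`. By reflection at most `n.choose (k - u)` walks reach level `u`
(`card_filter_reach_le`), and comparing with `(n - u).choose (k - u)`, which is log-concave in `u`,
gives `|A||B| ≤ (e ^ 2 / t) * (n - t).choose (k - t) ^ 2` if `u + v > 2 * t`. Let `u + v = 2 * t`.
If no walk in `A` has height `u` and touches level `u` exactly once, then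
`|A| ≤ 2 * (n - 1).choose (k - u - 1)` (`card_filter_reach_not_touchOnce_le`), and
`|A||B| ≤ 2 * e ^ 2 / (t + 1) * (n - t).choose (k - t) ^ 2`, which is small enough for `t ≥ 14`;
likewise for `B`. Otherwise all walks of smallest height in `A` and `B` are at level `u`,
respectively `v`, at one common time `t + s + s'`, where `u = t + s' - s` and `v = t + s - s'`.
If `s ≥ 2` or `s' ≥ 2`, the resulting upper bounds suffice (`card_mul_card_le_of_two_le`).

The remaining cases `s, s' ≤ 1` need a finer comparison, with the families `FA` and `FB` of all
sets with at least `t + s'`, respectively `t + s`, elements in `[t + s + s']`. Let `i` be the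
largest number such that some `G` in `B` touches its maximal level `v` once, at time `t + s + s'`,
and has no element among the `i` following times. Then `B` misses all members of `FB` that touch
once and then step down `i + 1` times, a proportion of about `(12 / 13) ^ (i + 1)` of `FB`
(`mul_card_initFamily_le_card_touchAt`), while the walks in `A` outside `FA` must exceed level `u`
later than `i` steps after the critical time, which is exponentially rarer (`card_le_of_late`).
So the relative excess of `A` is at most two thirds of the relative deficit of `B`, and vice versa
(`excess_le_deficit`); adding the two, the average relative size is at most `1` minus a fixed
multiple of the relative distance (`card_mul_add_card_mul_le`). For `s = s'` the reference families
are both `frankl t s n k` and this is the stability assertion; for `s ≠ s'` the product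
`|FA||FB|` is smaller than `(n - t).choose (k - t) ^ 2` by a factor depending on `t`
(`card_initFamily_mul_le`).

For the sharp bound near `frankl t s n k`: either both families contain a walk that touches level
`t` once, at time `t + 2 * s`, and the comparison applies, or one of them misses at least half of
`frankl t s n k`, which makes the average size too small (`card_add_card_lt`).
-/

/-! ### Walks and the duality of shifted cross intersecting families -/

/-- The number of elements of `F` among `1, …, m`: the number of up-steps among the first `m`
steps of the walk of `F`. -/
def pre (F : Finset ℕ) (m : ℕ) : ℕ := (F ∩ Finset.Icc 1 m).card

theorem pre_eq (F : Finset ℕ) (m : ℕ) : pre F m = (F ∩ Finset.Ioc 0 (0 + m)).card := by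
  unfold pre; congr 2; ext x; simp; omega

theorem pre_le (F : Finset ℕ) (m : ℕ) : pre F m ≤ m := by
  unfold pre
  exact (Finset.card_le_card Finset.inter_subset_right).trans (by simp)

theorem pre_le_card (F : Finset ℕ) (m : ℕ) : pre F m ≤ F.card :=
  Finset.card_le_card Finset.inter_subset_left

theorem pre_mono (F : Finset ℕ) {m m' : ℕ} (h : m ≤ m') : pre F m ≤ pre F m' :=
  Finset.card_le_card (Finset.inter_subset_inter_left (Finset.Icc_subset_Icc_right h))

theorem pre_succ (F : Finset ℕ) (m : ℕ) :
    pre F (m + 1) = pre F m + if m + 1 ∈ F then 1 else 0 := by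
  unfold pre
  have h : Finset.Icc 1 (m + 1) = insert (m + 1) (Finset.Icc 1 m) := by ext x; simp; omega
  rw [h]
  split_ifs with h1
  · rw [Finset.inter_insert_of_mem h1, Finset.card_insert_of_notMem (by simp)]
  · rw [Finset.inter_insert_of_notMem h1]; simp

theorem pre_add_le (F : Finset ℕ) (m d : ℕ) : pre F (m + d) ≤ pre F m + d := by
  induction d with
  | zero => simp
  | succ d ih =>
    rw [← add_assoc, pre_succ]; split_ifs <;> omega

theorem pre_zero (F : Finset ℕ) : pre F 0 = 0 := by simp [pre]

theorem card_of_mem_uniformSets {n k : ℕ} {F : Finset ℕ} (h : F ∈ uniformSets n k) :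
    F.card = k := (Finset.mem_powersetCard.1 h).2

theorem subset_of_mem_uniformSets {n k : ℕ} {F : Finset ℕ} (h : F ∈ uniformSets n k) :
    F ⊆ Finset.Icc 1 n := (Finset.mem_powersetCard.1 h).1

theorem pre_add_pre (F G : Finset ℕ) (m : ℕ) :
    pre F m + pre G m = pre (F ∪ G) m + pre (F ∩ G) m := by
  unfold pre
  rw [← Finset.card_union_add_card_inter, Finset.union_inter_distrib_right,
    ← Finset.inter_inter_distrib_right]

/-- The walks of two members of shifted cross `t`-intersecting families are together high at
some common time: otherwise shifting the `t`-th common element of the two sets to a position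
missed by both decreases the intersection, down to fewer than `t` elements. -/
theorem exists_pre_add_pre_ge {t n k : ℕ} (ht : 0 < t) {A B : Finset (Finset ℕ)}
    (hA : A ⊆ uniformSets n k) (hsA : IsShifted n A)
    (hAB : CrossIntersecting t A B) {F G : Finset ℕ} (hF : F ∈ A) (hG : G ∈ B) :
    ∃ m, m + t ≤ pre F m + pre G m := by
  induction hc : (F ∩ G).card using Nat.strong_induction_on generalizing F with
  | _ c ih =>
  by_contra! hcon
  have hFn := subset_of_mem_uniformSets (hA hF)
  have hex : ∃ m, t ≤ pre (F ∩ G) m := by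
    refine ⟨n, (hAB F hF G hG).trans (Finset.card_le_card ?_)⟩
    exact Finset.subset_inter subset_rfl (Finset.inter_subset_left.trans hFn)
  obtain ⟨m, hm, hmin⟩ : ∃ m, t ≤ pre (F ∩ G) m ∧ ∀ m' < m, pre (F ∩ G) m' < t := by
    classical
    exact ⟨Nat.find hex, Nat.find_spec hex, fun m' h => not_le.1 (Nat.find_min hex h)⟩
  -- `m + 1` is the `t`-th common element of `F` and `G`.
  obtain ⟨m, rfl⟩ : ∃ m', m = m' + 1 := by
    cases m with
    | zero => rw [pre_zero] at hm; omega
    | succ m => exact ⟨m, rfl⟩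
  have h1 := hmin m (by omega)
  have h2 := pre_succ (F ∩ G) m
  have hmS : m + 1 ∈ F ∩ G := by
    by_contra h; rw [if_neg h] at h2; omega
  rw [if_pos hmS] at h2
  have hmF := (Finset.mem_inter.1 hmS).1
  have hmG := (Finset.mem_inter.1 hmS).2
  have h3 := pre_add_pre F G (m + 1)
  have h4 := hcon (m + 1)
  obtain ⟨i, hi, hiU⟩ : ∃ i ∈ Finset.Icc 1 (m + 1), i ∉ (F ∪ G) ∩ Finset.Icc 1 (m + 1) := by
    by_contra! h
    have := Finset.card_le_card (show Finset.Icc 1 (m + 1) ⊆ (F ∪ G) ∩ Finset.Icc 1 (m + 1) from h)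
    rw [Nat.card_Icc] at this
    unfold pre at h3 h4 hm
    omega
  have hiU' : i ∉ F ∪ G := fun h => hiU (Finset.mem_inter.2 ⟨h, hi⟩)
  rw [Finset.mem_union, not_or] at hiU'
  rw [Finset.mem_Icc] at hi
  have him : i < m + 1 := lt_of_le_of_ne hi.2 (fun h => hiU'.1 (h ▸ hmF))
  have hmem := hsA i (m + 1) hi.1 him (Finset.mem_Icc.1 (hFn hmF)).2 F hF (by
    ext x; simp only [Finset.mem_inter, Finset.mem_insert, Finset.mem_singleton]
    constructor
    · rintro ⟨hx, rfl | rfl⟩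
      · exact absurd hx hiU'.1
      · rfl
    · rintro rfl; exact ⟨hmF, Or.inr rfl⟩)
  have hinter : (F \ {m + 1} ∪ {i}) ∩ G = (F ∩ G).erase (m + 1) := by
    ext x
    simp only [Finset.mem_inter, Finset.mem_union, Finset.mem_sdiff, Finset.mem_singleton,
      Finset.mem_erase]
    constructor
    · rintro ⟨⟨h1, h2⟩ | rfl, h3⟩
      · exact ⟨h2, h1, h3⟩
      · exact absurd h3 hiU'.2
    · rintro ⟨h1, h2, h3⟩; exact ⟨Or.inl ⟨h2, h1⟩, h3⟩
  obtain ⟨m', hm'⟩ := ih _ (by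
    rw [hinter, Finset.card_erase_of_mem hmS, hc]
    have : 0 < (F ∩ G).card := Finset.card_pos.2 ⟨_, hmS⟩
    omega) hmem rfl
  have h5 := hcon m'
  have h6 := pre_add_pre F G m'
  have h7 : pre (F \ {m + 1} ∪ {i}) m' ≤ pre F m' + 1 := by
    unfold pre
    refine (Finset.card_le_card (t := insert i (F ∩ Finset.Icc 1 m')) ?_).trans
      (Finset.card_insert_le _ _)
    intro x; simp only [Finset.mem_inter, Finset.mem_union, Finset.mem_sdiff,
      Finset.mem_singleton, Finset.mem_insert]; tauto
  rcases lt_or_ge m' i with h | h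
  · have : pre (F \ {m + 1} ∪ {i}) m' ≤ pre F m' := by
      refine Finset.card_le_card ?_
      intro x; simp only [Finset.mem_inter, Finset.mem_union, Finset.mem_sdiff,
        Finset.mem_singleton, Finset.mem_Icc]
      rintro ⟨⟨h1, _⟩ | rfl, h2⟩
      · exact ⟨h1, h2⟩
      · omega
    omega
  rcases lt_or_ge m' (m + 1) with h' | h'
  · have h8 := hmin m' h'
    have h9 : pre (F ∪ G) m' < m' := by
      unfold pre
      have : (F ∪ G) ∩ Finset.Icc 1 m' ⊂ Finset.Icc 1 m' := by
        refine Finset.ssubset_iff_subset_ne.2 ⟨Finset.inter_subset_right, fun he => ?_⟩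
        have : i ∈ (F ∪ G) ∩ Finset.Icc 1 m' := by
          rw [he]; exact Finset.mem_Icc.2 ⟨hi.1, h⟩
        have := (Finset.mem_inter.1 this).1
        rw [Finset.mem_union] at this; tauto
      simpa using Finset.card_lt_card this
    omega
  · have : pre (F \ {m + 1} ∪ {i}) m' ≤ pre F m' := by
      unfold pre
      have hsub : (F \ {m + 1} ∪ {i}) ∩ Finset.Icc 1 m' ⊆
          insert i ((F ∩ Finset.Icc 1 m').erase (m + 1)) := by
        intro x; simp only [Finset.mem_inter, Finset.mem_union, Finset.mem_sdiff,
          Finset.mem_singleton, Finset.mem_insert, Finset.mem_erase]; tauto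
      refine (Finset.card_le_card hsub).trans ((Finset.card_insert_le _ _).trans ?_)
      have hmm : m + 1 ∈ F ∩ Finset.Icc 1 m' :=
        Finset.mem_inter.2 ⟨hmF, Finset.mem_Icc.2 ⟨by omega, h'⟩⟩
      rw [Finset.card_erase_of_mem hmm]
      have : 0 < (F ∩ Finset.Icc 1 m').card := Finset.card_pos.2 ⟨_, hmm⟩
      omega
    omega

/-! ### Counting walks that reach a level -/

/-- The walk that starts at time `a` and goes up at the times in `F` reaches level `u`. -/
def Reach (a u : ℕ) (F : Finset ℕ) : Prop :=
  ∃ d, d + u ≤ 2 * (F ∩ Finset.Ioc a (a + d)).card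

/-- The walk that starts at time `a` and goes up at the times in `F` has maximal level `u`, and
it is at this level exactly once. -/
def TouchOnce (a u : ℕ) (F : Finset ℕ) : Prop :=
  ∃ d, 2 * (F ∩ Finset.Ioc a (a + d)).card = d + u ∧
    ∀ e, e ≠ d → 2 * (F ∩ Finset.Ioc a (a + e)).card < e + u

theorem reach_zero (a : ℕ) (F : Finset ℕ) : Reach a 0 F := ⟨0, by simp⟩

theorem Reach.mono {a u v : ℕ} {F : Finset ℕ} (h : Reach a v F) (huv : u ≤ v) : Reach a u F := by
  obtain ⟨d, hd⟩ := h; exact ⟨d, by omega⟩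

theorem Reach.le_card {a u : ℕ} {F : Finset ℕ} (h : Reach a u F) : u ≤ F.card := by
  obtain ⟨d, hd⟩ := h
  have h1 : (F ∩ Finset.Ioc a (a + d)).card ≤ F.card :=
    Finset.card_le_card Finset.inter_subset_left
  have h2 : (F ∩ Finset.Ioc a (a + d)).card ≤ d :=
    (Finset.card_le_card Finset.inter_subset_right).trans (by simp)
  omega

theorem Reach.touchOnce {a u : ℕ} {F : Finset ℕ} (h : Reach a u F) (hu : F.card = u) :
    TouchOnce a u F := by
  obtain ⟨d, hd⟩ := h
  have h1 : ∀ e, (F ∩ Finset.Ioc a (a + e)).card ≤ F.card := fun e =>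
    Finset.card_le_card Finset.inter_subset_left
  have h2 : ∀ e, (F ∩ Finset.Ioc a (a + e)).card ≤ e := fun e =>
    (Finset.card_le_card Finset.inter_subset_right).trans (by simp)
  have := h1 d
  have := h2 d
  refine ⟨d, by omega, fun e he => ?_⟩
  have := h1 e
  have := h2 e
  omega

theorem Ioc_succ_eq_insert (a d : ℕ) :
    Finset.Ioc a (a + (d + 1)) = insert (a + 1) (Finset.Ioc (a + 1) (a + 1 + d)) := by
  ext x; simp; omega

theorem card_insert_inter_Ioc {a : ℕ} {F : Finset ℕ} (hF : a + 1 ∉ F) (d : ℕ) :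
    (insert (a + 1) F ∩ Finset.Ioc a (a + (d + 1))).card =
      (F ∩ Finset.Ioc (a + 1) (a + 1 + d)).card + 1 := by
  rw [Ioc_succ_eq_insert, ← Finset.insert_inter_distrib, Finset.card_insert_of_notMem]
  simp [hF]

theorem card_inter_Ioc_of_notMem {a : ℕ} {F : Finset ℕ} (hF : a + 1 ∉ F) (d : ℕ) :
    (F ∩ Finset.Ioc a (a + (d + 1))).card = (F ∩ Finset.Ioc (a + 1) (a + 1 + d)).card := by
  rw [Ioc_succ_eq_insert, Finset.inter_insert_of_notMem hF]

theorem reach_insert {a u : ℕ} {F : Finset ℕ} (hF : a + 1 ∉ F) :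
    Reach a (u + 1) (insert (a + 1) F) ↔ Reach (a + 1) u F := by
  constructor
  · rintro ⟨d, hd⟩
    cases d with
    | zero => simp at hd
    | succ d => rw [card_insert_inter_Ioc hF] at hd; exact ⟨d, by omega⟩
  · rintro ⟨d, hd⟩
    exact ⟨d + 1, by rw [card_insert_inter_Ioc hF]; omega⟩

theorem reach_of_notMem {a u : ℕ} {F : Finset ℕ} (hF : a + 1 ∉ F) :
    Reach a (u + 1) F ↔ Reach (a + 1) (u + 2) F := by
  constructor
  · rintro ⟨d, hd⟩
    cases d with
    | zero => simp at hd
    | succ d => rw [card_inter_Ioc_of_notMem hF] at hd; exact ⟨d, by omega⟩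
  · rintro ⟨d, hd⟩
    exact ⟨d + 1, by rw [card_inter_Ioc_of_notMem hF]; omega⟩

theorem TouchOnce.insert {a u : ℕ} {F : Finset ℕ} (hF : a + 1 ∉ F)
    (h : TouchOnce (a + 1) u F) : TouchOnce a (u + 1) (insert (a + 1) F) := by
  obtain ⟨d, hd, he⟩ := h
  refine ⟨d + 1, by rw [card_insert_inter_Ioc hF]; omega, fun e hne => ?_⟩
  cases e with
  | zero => simp
  | succ e =>
    rw [card_insert_inter_Ioc hF]
    have := he e (by omega)
    omega

theorem TouchOnce.of_notMem {a u : ℕ} {F : Finset ℕ} (hF : a + 1 ∉ F)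
    (h : TouchOnce (a + 1) (u + 2) F) : TouchOnce a (u + 1) F := by
  obtain ⟨d, hd, he⟩ := h
  refine ⟨d + 1, by rw [card_inter_Ioc_of_notMem hF]; omega, fun e hne => ?_⟩
  cases e with
  | zero => simp
  | succ e =>
    rw [card_inter_Ioc_of_notMem hF]
    have := he e (by omega)
    omega

/-- A walk whose first step is down touches level `0` once unless it comes back to it. -/
theorem touchOnce_zero_of_not_reach {a : ℕ} {F : Finset ℕ} (hF : a + 1 ∉ F)
    (h : ¬ Reach (a + 1) 1 F) : TouchOnce a 0 F := by
  refine ⟨0, by simp, fun e he => ?_⟩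
  cases e with
  | zero => exact absurd rfl he
  | succ e =>
    rw [card_inter_Ioc_of_notMem hF]
    by_contra hc
    exact h ⟨e, by omega⟩

/-- Splitting the sets in an interval according to their first possible element. -/
theorem card_filter_powersetCard_Ioc_succ (a n k : ℕ) (p : Finset ℕ → Prop)
    [DecidablePred p] :
    ((Finset.powersetCard (k + 1) (Finset.Ioc a (a + (n + 1)))).filter p).card =
      ((Finset.powersetCard (k + 1) (Finset.Ioc (a + 1) (a + 1 + n))).filter p).card +
      ((Finset.powersetCard k (Finset.Ioc (a + 1) (a + 1 + n))).filter
        fun F => p (insert (a + 1) F)).card := by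
  have hn : a + 1 ∉ Finset.Ioc (a + 1) (a + 1 + n) := by simp
  rw [Ioc_succ_eq_insert, Finset.powersetCard_succ_insert hn, Finset.filter_union,
    Finset.card_union_of_disjoint, Finset.filter_image, Finset.card_image_of_injOn]
  · intro F hF G hG h
    have hF' : a + 1 ∉ F := fun h' =>
      hn ((Finset.mem_powersetCard.1 (Finset.mem_filter.1 hF).1).1 h')
    have hG' : a + 1 ∉ G := fun h' =>
      hn ((Finset.mem_powersetCard.1 (Finset.mem_filter.1 hG).1).1 h')
    rw [← Finset.erase_insert hF', ← Finset.erase_insert hG']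
    exact congrArg (fun s => s.erase (a + 1)) h
  · rw [Finset.disjoint_left]
    intro F hF hF'
    obtain ⟨G, _, rfl⟩ := Finset.mem_image.1 (Finset.mem_filter.1 hF').1
    exact hn ((Finset.mem_powersetCard.1 (Finset.mem_filter.1 hF).1).1
      (Finset.mem_insert_self _ _))

theorem notMem_of_mem_powersetCard_Ioc {a n k : ℕ} {F : Finset ℕ}
    (hF : F ∈ Finset.powersetCard k (Finset.Ioc (a + 1) (a + 1 + n))) : a + 1 ∉ F := fun h => by
  have := (Finset.mem_powersetCard.1 hF).1 h
  simp at this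

open Classical in
/-- The reflection bound for the number of walks that reach level `u`. -/
theorem card_filter_reach_le (n a K u : ℕ) :
    ((Finset.powersetCard (K + u) (Finset.Ioc a (a + n))).filter (Reach a u)).card ≤
      n.choose K := by
  induction n generalizing a K u with
  | zero =>
    cases K with
    | zero =>
      refine (Finset.card_filter_le _ _).trans ?_
      rw [Finset.card_powersetCard]
      cases u <;> simp
    | succ K =>
      refine (Finset.card_filter_le _ _).trans ?_
      rw [Finset.card_powersetCard]
      simp
      rw [Nat.choose_eq_zero_of_lt]; omega
  | succ n ih =>
    cases u with
    | zero =>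
      refine (Finset.card_filter_le _ _).trans ?_
      rw [Finset.card_powersetCard]
      simp
    | succ u =>
      rw [← add_assoc, card_filter_powersetCard_Ioc_succ]
      have h1 : ((Finset.powersetCard (K + u) (Finset.Ioc (a + 1) (a + 1 + n))).filter
          fun F => Reach a (u + 1) (insert (a + 1) F)).card ≤ n.choose K := by
        refine le_trans (Finset.card_le_card ?_) (ih (a + 1) K u)
        intro F hF
        rw [Finset.mem_filter] at hF ⊢
        exact ⟨hF.1, (reach_insert (notMem_of_mem_powersetCard_Ioc hF.1)).1 hF.2⟩
      cases K with
      | zero =>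
        have h2 : ((Finset.powersetCard (0 + u + 1) (Finset.Ioc (a + 1) (a + 1 + n))).filter
            (Reach a (u + 1))).card = 0 := by
          rw [Finset.card_eq_zero, Finset.filter_eq_empty_iff]
          intro F hF hr
          have := ((reach_of_notMem (notMem_of_mem_powersetCard_Ioc hF)).1 hr).le_card
          rw [(Finset.mem_powersetCard.1 hF).2] at this
          omega
        rw [h2]; simpa using h1
      | succ K =>
        have h2 : ((Finset.powersetCard (K + 1 + u + 1) (Finset.Ioc (a + 1) (a + 1 + n))).filter
            (Reach a (u + 1))).card ≤ n.choose K := by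
          refine le_trans (Finset.card_le_card ?_) (ih (a + 1) K (u + 2))
          intro F hF
          rw [Finset.mem_filter] at hF ⊢
          refine ⟨?_, (reach_of_notMem (notMem_of_mem_powersetCard_Ioc hF.1)).1 hF.2⟩
          convert hF.1 using 2; omega
        rw [Nat.choose_succ_succ']
        omega

open Classical in
/-- The number of walks that reach level `u` other than by having it as maximal level and
visiting it once. A walk of the excluded kind steps down after its only visit to level `u`;
deleting this step gives a shorter walk of maximal level `u`. -/
theorem card_filter_reach_not_touchOnce_le (n a K u : ℕ) :
    ((Finset.powersetCard (K + 1 + u) (Finset.Ioc a (a + (n + 1)))).filter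
      fun F => Reach a u F ∧ ¬ TouchOnce a u F).card ≤ 2 * n.choose K := by
  induction n generalizing a K u with
  | zero =>
    refine (Finset.card_filter_le _ _).trans ?_
    rw [Finset.card_powersetCard]
    cases K with
    | zero => cases u <;> simp [Nat.choose_eq_zero_of_lt]
    | succ K => simp; rw [Nat.choose_eq_zero_of_lt]; omega
  | succ n ih =>
    cases u with
    | zero =>
      rw [add_zero, card_filter_powersetCard_Ioc_succ]
      have h1 : ((Finset.powersetCard K (Finset.Ioc (a + 1) (a + 1 + (n + 1)))).filter
          fun F => Reach a 0 (insert (a + 1) F) ∧ ¬ TouchOnce a 0 (insert (a + 1) F)).card ≤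
          (n + 1).choose K := by
        refine (Finset.card_filter_le _ _).trans ?_
        rw [Finset.card_powersetCard]; simp
      have h2 : ((Finset.powersetCard (K + 1) (Finset.Ioc (a + 1) (a + 1 + (n + 1)))).filter
          fun F => Reach a 0 F ∧ ¬ TouchOnce a 0 F).card ≤ (n + 1).choose K := by
        refine le_trans (Finset.card_le_card ?_) (card_filter_reach_le (n + 1) (a + 1) K 1)
        intro F hF
        rw [Finset.mem_filter] at hF ⊢
        refine ⟨hF.1, ?_⟩
        by_contra hr
        exact hF.2.2 (touchOnce_zero_of_not_reach (notMem_of_mem_powersetCard_Ioc hF.1) hr)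
      omega
    | succ u =>
      rw [← add_assoc, card_filter_powersetCard_Ioc_succ]
      have h1 : ((Finset.powersetCard (K + 1 + u) (Finset.Ioc (a + 1) (a + 1 + (n + 1)))).filter
          fun F => Reach a (u + 1) (insert (a + 1) F) ∧
            ¬ TouchOnce a (u + 1) (insert (a + 1) F)).card ≤ 2 * n.choose K := by
        refine le_trans (Finset.card_le_card ?_) (ih (a + 1) K u)
        intro F hF
        rw [Finset.mem_filter] at hF ⊢
        have hn := notMem_of_mem_powersetCard_Ioc hF.1
        exact ⟨hF.1, (reach_insert hn).1 hF.2.1, fun h => hF.2.2 (h.insert hn)⟩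
      cases K with
      | zero =>
        have h2 : ((Finset.powersetCard (0 + 1 + u + 1)
            (Finset.Ioc (a + 1) (a + 1 + (n + 1)))).filter
            fun F => Reach a (u + 1) F ∧ ¬ TouchOnce a (u + 1) F).card = 0 := by
          rw [Finset.card_eq_zero, Finset.filter_eq_empty_iff]
          intro F hF hr
          have hn := notMem_of_mem_powersetCard_Ioc hF
          refine hr.2 (TouchOnce.of_notMem hn (((reach_of_notMem hn).1 hr.1).touchOnce ?_))
          rw [(Finset.mem_powersetCard.1 hF).2]; omega
        rw [h2]; simpa using h1
      | succ K =>
        have h2 : ((Finset.powersetCard (K + 1 + 1 + u + 1)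
            (Finset.Ioc (a + 1) (a + 1 + (n + 1)))).filter
            fun F => Reach a (u + 1) F ∧ ¬ TouchOnce a (u + 1) F).card ≤ 2 * n.choose K := by
          refine le_trans (Finset.card_le_card ?_) (ih (a + 1) K (u + 2))
          intro F hF
          rw [Finset.mem_filter] at hF ⊢
          have hn := notMem_of_mem_powersetCard_Ioc hF.1
          refine ⟨?_, (reach_of_notMem hn).1 hF.2.1, fun h => hF.2.2 (h.of_notMem hn)⟩
          convert hF.1 using 2; omega
        rw [Nat.choose_succ_succ']
        omega

/-! ### Sets with prescribed initial segments -/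

theorem reach_zero_iff {u : ℕ} {F : Finset ℕ} : Reach 0 u F ↔ ∃ m, m + u ≤ 2 * pre F m := by
  simp only [Reach, pre_eq]

theorem card_le_choose_mul_choose {S : Finset (Finset ℕ)} (X Y Z : Finset ℕ) {c d : ℕ}
    (h : ∀ F ∈ S, (F ∩ X).card = c ∧ (F ∩ Y).card = d ∧ F = Z ∪ (F ∩ X ∪ F ∩ Y)) :
    S.card ≤ X.card.choose c * Y.card.choose d := by
  rw [← Finset.card_powersetCard, ← Finset.card_powersetCard, ← Finset.card_product]
  refine Finset.card_le_card_of_injOn (fun F => (F ∩ X, F ∩ Y)) ?_ ?_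
  · intro F hF
    obtain ⟨h1, h2, _⟩ := h F hF
    simp [Finset.mem_powersetCard, h1, h2]
  · intro F hF G hG he
    rw [(h F hF).2.2, (h G hG).2.2]
    simp only [Prod.mk.injEq] at he
    rw [he.1, he.2]

theorem card_mul_card_le_of_union_mem {P Q S : Finset (Finset ℕ)} {X Y : Finset ℕ}
    (hXY : Disjoint X Y) (hP : ∀ p ∈ P, p ⊆ X) (hQ : ∀ q ∈ Q, q ⊆ Y)
    (h : ∀ p ∈ P, ∀ q ∈ Q, p ∪ q ∈ S) : P.card * Q.card ≤ S.card := by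
  rw [← Finset.card_product]
  refine Finset.card_le_card_of_injOn (fun x => x.1 ∪ x.2) ?_ ?_
  · rintro ⟨p, q⟩ hx
    have := Finset.mem_product.1 hx
    exact h p this.1 q this.2
  · have key : ∀ p ∈ P, ∀ q ∈ Q, (p ∪ q) ∩ X = p ∧ (p ∪ q) ∩ Y = q := by
      intro p hp q hq
      have h1 := hP p hp
      have h2 := hQ q hq
      rw [Finset.disjoint_left] at hXY
      constructor
      · ext x; simp only [Finset.mem_inter, Finset.mem_union]
        exact ⟨fun ⟨h3, h4⟩ => h3.resolve_right fun h5 => hXY h4 (h2 h5),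
          fun h3 => ⟨Or.inl h3, h1 h3⟩⟩
      · ext x; simp only [Finset.mem_inter, Finset.mem_union]
        exact ⟨fun ⟨h3, h4⟩ => h3.resolve_left fun h5 => hXY (h1 h5) h4,
          fun h3 => ⟨Or.inr h3, h2 h3⟩⟩
    rintro ⟨p, q⟩ hx ⟨p', q'⟩ hx' he
    have hx := Finset.mem_product.1 hx
    have hx' := Finset.mem_product.1 hx'
    simp only at he hx hx'
    have h1 := key p hx.1 q hx.2
    have h2 := key p' hx'.1 q' hx'.2
    rw [he] at h1
    rw [Prod.mk.injEq]
    exact ⟨h1.1.symm.trans h2.1, h1.2.symm.trans h2.2⟩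

theorem inter_Icc_union_inter_Ioc {F : Finset ℕ} {n : ℕ} (hF : F ⊆ Finset.Icc 1 n) (m : ℕ) :
    F = F ∩ Finset.Icc 1 m ∪ F ∩ Finset.Ioc m n := by
  ext x
  have := @hF x
  simp only [Finset.mem_union, Finset.mem_inter, Finset.mem_Icc, Finset.mem_Ioc] at this ⊢
  constructor
  · intro h; have := this h; by_cases h' : x ≤ m
    · exact Or.inl ⟨h, by omega⟩
    · exact Or.inr ⟨h, by omega⟩
  · tauto

theorem pre_add_card_inter_Ioc {F : Finset ℕ} {n k : ℕ} (hF : F ∈ uniformSets n k) (m : ℕ) :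
    pre F m + (F ∩ Finset.Ioc m n).card = k := by
  have h := inter_Icc_union_inter_Ioc (subset_of_mem_uniformSets hF) m
  rw [← card_of_mem_uniformSets hF]
  conv_rhs => rw [h]
  rw [Finset.card_union_of_disjoint]
  · rfl
  · rw [Finset.disjoint_left]; intro x; simp; omega

/-- Sets with a prescribed number of elements in an initial segment. -/
theorem card_filter_pre_eq_le (n k m c : ℕ) :
    ((uniformSets n k).filter fun F => pre F m = c).card ≤
      m.choose c * (n - m).choose (k - c) := by
  have := card_le_choose_mul_choose (S := (uniformSets n k).filter fun F => pre F m = c)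
    (Finset.Icc 1 m) (Finset.Ioc m n) ∅ (c := c) (d := k - c) (by
      intro F hF
      obtain ⟨hF, hc⟩ := Finset.mem_filter.1 hF
      have h1 := pre_add_card_inter_Ioc hF m
      refine ⟨hc, by omega, ?_⟩
      rw [Finset.empty_union]
      exact inter_Icc_union_inter_Ioc (subset_of_mem_uniformSets hF) m)
  simpa using this

theorem card_filter_pre_eq_mem_le (n k m c : ℕ) :
    ((uniformSets n k).filter fun F => pre F (m + 1) = c + 1 ∧ m + 1 ∈ F).card ≤
      m.choose c * (n - (m + 1)).choose (k - (c + 1)) := by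
  have := card_le_choose_mul_choose
    (S := (uniformSets n k).filter fun F => pre F (m + 1) = c + 1 ∧ m + 1 ∈ F)
    (Finset.Icc 1 m) (Finset.Ioc (m + 1) n) {m + 1} (c := c) (d := k - (c + 1)) (by
      intro F hF
      obtain ⟨hF, hc, hm⟩ := Finset.mem_filter.1 hF
      have h1 := pre_add_card_inter_Ioc hF (m + 1)
      have h2 := pre_succ F m
      rw [if_pos hm] at h2
      refine ⟨show pre F m = c by omega, by omega, ?_⟩
      ext x
      have hx := @subset_of_mem_uniformSets _ _ _ hF x
      simp only [Finset.mem_union, Finset.mem_inter, Finset.mem_Icc, Finset.mem_Ioc,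
        Finset.mem_singleton] at hx ⊢
      constructor
      · intro h; have := hx h
        rcases lt_trichotomy x (m + 1) with h' | h' | h'
        · exact Or.inr (Or.inl ⟨h, by omega⟩)
        · exact Or.inl h'
        · exact Or.inr (Or.inr ⟨h, by omega⟩)
      · rintro (rfl | h | h)
        · exact hm
        · exact h.1
        · exact h.1)
  simpa using this

theorem choose_mul_choose_le_card_filter_pre_eq {n k m c : ℕ} (hm : m ≤ n) (hc : c ≤ k) :
    m.choose c * (n - m).choose (k - c) ≤
      ((uniformSets n k).filter fun F => pre F m = c).card := by
  have := card_mul_card_le_of_union_mem (P := Finset.powersetCard c (Finset.Icc 1 m))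
    (Q := Finset.powersetCard (k - c) (Finset.Ioc m n)) (X := Finset.Icc 1 m)
    (Y := Finset.Ioc m n) (S := (uniformSets n k).filter fun F => pre F m = c)
    (by rw [Finset.disjoint_left]; intro x; simp; omega)
    (fun p hp => (Finset.mem_powersetCard.1 hp).1) (fun p hp => (Finset.mem_powersetCard.1 hp).1)
    (by
      intro p hp q hq
      rw [Finset.mem_powersetCard] at hp hq
      have hd : Disjoint p q := by
        rw [Finset.disjoint_left]; intro x h1 h2
        have h1 := hp.1 h1
        have h2 := hq.1 h2
        simp at h1 h2; omega
      rw [Finset.mem_filter]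
      constructor
      · refine Finset.mem_powersetCard.2 ⟨?_, ?_⟩
        · intro x hx
          rcases Finset.mem_union.1 hx with h | h
          · have := hp.1 h; simp at this ⊢; omega
          · have := hq.1 h; simp at this ⊢; omega
        · rw [Finset.card_union_of_disjoint hd, hp.2, hq.2]; omega
      · unfold pre
        rw [Finset.union_inter_distrib_right, Finset.inter_eq_left.2 hp.1,
          show q ∩ Finset.Icc 1 m = ∅ from ?_, Finset.union_empty, hp.2]
        ext x; simp; intro h; have := hq.1 h; simp at this; omega)
  simpa using this

/-! ### Inequalities between binomial coefficients -/

theorem choose_add_le {τ N K : ℕ} (hτ : 0 < τ) (h : (τ + 1) * K ≤ N + 1) (r : ℕ) :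
    ((N + r).choose K : ℝ) ≤ (((τ : ℝ) + 1) / τ) ^ r * (N.choose K : ℝ) := by
  have hτ' : (0 : ℝ) < τ := by exact_mod_cast hτ
  induction r with
  | zero => simp
  | succ r ih =>
    have h1 : (N + r + 1).choose K * (N + r + 1 - K) = (N + r).choose K * (N + r + 1) :=
      (Nat.choose_mul_succ_eq (N + r) K).symm
    have h2 : K ≤ N + r + 1 := by nlinarith
    have h3 : ((N + r + 1).choose K : ℝ) * ((N : ℝ) + r + 1 - K)
        = ((N + r).choose K : ℝ) * ((N : ℝ) + r + 1) := by
      have := congrArg (Nat.cast (R := ℝ)) h1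
      push_cast [Nat.cast_sub h2] at this
      linarith
    have h4 : ((τ : ℝ) + 1) * K ≤ N + 1 := by exact_mod_cast h
    have hr : (0 : ℝ) ≤ r := Nat.cast_nonneg r
    have hK : (0 : ℝ) ≤ K := Nat.cast_nonneg K
    have h5 : (N + r + 1).choose K * (τ : ℝ) ≤ (τ + 1) * (N + r).choose K := by
      by_cases hK0 : (N : ℝ) + r + 1 - K ≤ 0
      · exfalso; nlinarith
      · push Not at hK0
        refine le_of_mul_le_mul_right ?_ hK0
        have hc : (0 : ℝ) ≤ (N + r).choose K := Nat.cast_nonneg _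
        calc ((N + r + 1).choose K * (τ : ℝ)) * ((N : ℝ) + r + 1 - K)
            = τ * ((N + r).choose K * ((N : ℝ) + r + 1)) := by rw [← h3]; ring
          _ ≤ _ := by
            have : (τ : ℝ) * ((N : ℝ) + r + 1) ≤ (τ + 1) * ((N : ℝ) + r + 1 - K) := by nlinarith
            nlinarith
    rw [pow_succ, ← add_assoc, mul_right_comm]
    calc ((N + r + 1).choose K : ℝ) ≤ (τ + 1) / τ * (N + r).choose K := by
          rw [div_mul_eq_mul_div, le_div_iff₀ hτ']; exact h5
      _ ≤ (τ + 1) / τ * ((((τ : ℝ) + 1) / τ) ^ r * (N.choose K : ℝ)) := by gcongr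
      _ = _ := by ring

theorem pow_mul_choose_sub_le {t N K s : ℕ} (h : (t + 1) * K ≤ N) (hs : s ≤ K) :
    (t + 1) ^ s * (N - s).choose (K - s) ≤ N.choose K := by
  induction s with
  | zero => simp
  | succ s ih =>
    refine le_trans ?_ (ih (by omega))
    rw [pow_succ, mul_assoc]
    refine Nat.mul_le_mul_left _ ?_
    have hKN : K ≤ N := by nlinarith
    obtain ⟨K', hK'⟩ : ∃ K', K - s = K' + 1 := ⟨K - s - 1, by omega⟩
    obtain ⟨N', hN'⟩ : ∃ N', N - s = N' + 1 := ⟨N - s - 1, by omega⟩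
    rw [show K - (s + 1) = K' by omega, show N - (s + 1) = N' by omega, hK', hN']
    have h1 := Nat.add_one_mul_choose_eq N' K'
    have h2 : (t + 1) * (K' + 1) ≤ N' + 1 := by
      rw [← hK', ← hN']
      have : (t + 1) * (K - s) + (t + 1) * s = (t + 1) * K := by
        rw [← mul_add]; congr 1; omega
      have : s ≤ (t + 1) * s := by nlinarith
      omega
    have h3 : 0 < K' + 1 := by omega
    refine Nat.le_of_mul_le_mul_right ?_ h3
    rw [← h1]
    nlinarith [Nat.zero_le (N'.choose K')]

theorem mul_choose_le_choose_succ {τ N K : ℕ} (h : τ * (K + 1) ≤ N - K) :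
    τ * N.choose K ≤ N.choose (K + 1) := by
  refine Nat.le_of_mul_le_mul_right ?_ (Nat.succ_pos K)
  rw [Nat.succ_eq_add_one, Nat.choose_succ_right_eq]
  nlinarith [Nat.zero_le (N.choose K)]

/-! ### Binomial coefficients of stars -/

/-- The number of `k`-element subsets of `[n]` that contain `j` given elements. -/
def starCard (n k j : ℕ) : ℕ := (n - j).choose (k - j)

theorem starCard_pos {n k : ℕ} (h : k ≤ n) (j : ℕ) : 0 < starCard n k j :=
  Nat.choose_pos (by omega)

theorem pow_mul_starCard_add_le {t n k j s : ℕ} (hn : (t + 1) * k ≤ n) (hj : j + s ≤ k) :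
    (t + 1) ^ s * starCard n k (j + s) ≤ starCard n k j := by
  have h : (t + 1) * (k - j) ≤ n - j := by
    have : (t + 1) * (k - j) + (t + 1) * j = (t + 1) * k := by
      rw [← mul_add]; congr 1; omega
    have : j ≤ (t + 1) * j := by nlinarith
    omega
  have := pow_mul_choose_sub_le h (s := s) (by omega)
  unfold starCard
  rwa [Nat.sub_sub, Nat.sub_sub] at this

theorem starCard_succ_mul {n k j : ℕ} (hj : j < k) (hk : k ≤ n) :
    (n - j) * starCard n k (j + 1) = (k - j) * starCard n k j := by
  unfold starCard
  obtain ⟨a, ha⟩ : ∃ a, k - j = a + 1 := ⟨k - j - 1, by omega⟩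
  obtain ⟨b, hb⟩ : ∃ b, n - j = b + 1 := ⟨n - j - 1, by omega⟩
  rw [show k - (j + 1) = a by omega, show n - (j + 1) = b by omega, ha, hb,
    Nat.add_one_mul_choose_eq, mul_comm]

theorem starCard_mul_starCard_le_step {n k i j : ℕ} (hij : i ≤ j) (hj : j < k) (hk : k ≤ n) :
    starCard n k i * starCard n k (j + 1) ≤ starCard n k (i + 1) * starCard n k j := by
  have h1 := starCard_succ_mul (by omega : i < k) hk
  have h2 := starCard_succ_mul hj hk
  have hpos : 0 < (n - j) * (k - i) := Nat.mul_pos (by omega) (by omega)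
  refine Nat.le_of_mul_le_mul_left ?_ hpos
  have h3 : (k - j) * (n - i) ≤ (n - j) * (k - i) := by
    obtain ⟨d, rfl⟩ := Nat.exists_eq_add_of_le hij
    obtain ⟨a, rfl⟩ := Nat.exists_eq_add_of_le hj.le
    obtain ⟨b, rfl⟩ := Nat.exists_eq_add_of_le hk
    rw [show i + d + a - (i + d) = a by omega, show i + d + a + b - i = d + a + b by omega,
      show i + d + a + b - (i + d) = a + b by omega, show i + d + a - i = d + a by omega]
    nlinarith [Nat.zero_le (b * d)]
  calc (n - j) * (k - i) * (starCard n k i * starCard n k (j + 1))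
      = ((k - i) * starCard n k i) * ((n - j) * starCard n k (j + 1)) := by ring
    _ = ((k - j) * (n - i)) * (starCard n k (i + 1) * starCard n k j) := by rw [← h1, h2]; ring
    _ ≤ _ := Nat.mul_le_mul_right _ h3

theorem starCard_sub_mul_starCard_add_le {t n k a : ℕ} (ha : a ≤ t) (hk : t + a ≤ k)
    (hn : k ≤ n) : starCard n k (t - a) * starCard n k (t + a) ≤ starCard n k t ^ 2 := by
  induction a with
  | zero => simp [sq]
  | succ a ih =>
    refine le_trans ?_ (ih (by omega) (by omega))
    have := starCard_mul_starCard_le_step (n := n) (k := k) (i := t - (a + 1)) (j := t + a)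
      (by omega) (by omega) hn
    rwa [show t - (a + 1) + 1 = t - a by omega] at this

/-- Log-concavity of `starCard n k`, combined with its decay by a factor `t + 1` at each step. -/
theorem pow_mul_starCard_mul_starCard_le {t n k u v x : ℕ} (hn : (t + 1) * k ≤ n)
    (hu : u ≤ k) (hv : v ≤ k) (huv : u + v = 2 * t + x) :
    (t + 1) ^ x * (starCard n k u * starCard n k v) ≤ starCard n k t ^ 2 := by
  wlog h : u ≤ v generalizing u v
  · rw [mul_comm (starCard n k u)]
    exact this hv hu (by omega) (by omega)
  have hkn : k ≤ n := by nlinarith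
  rcases le_total u t with hut | hut
  · obtain ⟨a, ha, rfl⟩ : ∃ a, a ≤ t ∧ u = t - a := ⟨t - u, by omega, by omega⟩
    obtain rfl : v = t + a + x := by omega
    have h1 := pow_mul_starCard_add_le hn hv
    have h2 := starCard_sub_mul_starCard_add_le ha (by omega) hkn
    calc _ = starCard n k (t - a) * ((t + 1) ^ x * starCard n k (t + a + x)) := by ring
      _ ≤ starCard n k (t - a) * starCard n k (t + a) := Nat.mul_le_mul_left _ h1
      _ ≤ _ := h2
  · obtain ⟨a, rfl⟩ := Nat.exists_eq_add_of_le hut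
    obtain ⟨b, rfl⟩ := Nat.exists_eq_add_of_le (hut.trans h)
    have h1 := pow_mul_starCard_add_le hn hu
    have h2 := pow_mul_starCard_add_le hn hv
    rw [show x = a + b by omega, pow_add, sq]
    calc _ = ((t + 1) ^ a * starCard n k (t + a)) * ((t + 1) ^ b * starCard n k (t + b)) := by ring
      _ ≤ _ := Nat.mul_le_mul h1 h2

/-- The reflection bound for the walks that reach level `u`, compared with the walks whose first
`u` steps are up. -/
theorem choose_sub_le {t n k u : ℕ} (ht : 0 < t) (hn : (t + 1) * k ≤ n) (hu : u ≤ k) :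
    (n.choose (k - u) : ℝ) ≤ (((t : ℝ) + 1) / t) ^ u * starCard n k u := by
  have h : (t + 1) * (k - u) ≤ n - u + 1 := by
    have : (t + 1) * (k - u) + (t + 1) * u = (t + 1) * k := by
      rw [← mul_add]; congr 1; omega
    have : u ≤ (t + 1) * u := by nlinarith
    omega
  have hkn : k ≤ n := by nlinarith
  have := choose_add_le ht h u
  rwa [show n - u + u = n by omega] at this

theorem choose_sub_succ_le {t n k u : ℕ} (ht : 0 < t) (hn : (t + 1) * k ≤ n) (hu : u + 1 ≤ k) :
    (n.choose (k - (u + 1)) : ℝ) ≤ (((t : ℝ) + 1) / t) ^ u / t * starCard n k u := by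
  have h1 : t * n.choose (k - (u + 1)) ≤ n.choose (k - u) := by
    rw [show k - u = k - (u + 1) + 1 by omega]
    apply mul_choose_le_choose_succ
    have : t * (k - (u + 1) + 1) ≤ t * k := Nat.mul_le_mul_left _ (by omega)
    have : (t + 1) * k = t * k + k := by ring
    omega
  have h2 := choose_sub_le ht hn (by omega : u ≤ k)
  have h3 : (t : ℝ) * n.choose (k - (u + 1)) ≤ n.choose (k - u) := by exact_mod_cast h1
  have ht' : (0 : ℝ) < t := by exact_mod_cast ht
  rw [div_mul_eq_mul_div, le_div_iff₀ ht']
  linarith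

theorem choose_sub_two_mul_le {t n k u s : ℕ} (hn : (t + 1) * k ≤ n) (hu : u + s ≤ k) :
    ((n - (u + 2 * s)).choose (k - (u + s)) : ℝ) ≤ starCard n k u / ((t : ℝ) + 1) ^ s := by
  rw [le_div_iff₀ (by positivity)]
  have h1 := pow_mul_starCard_add_le hn hu
  have h2 : (n - (u + 2 * s)).choose (k - (u + s)) ≤ starCard n k (u + s) :=
    Nat.choose_le_choose _ (by omega)
  have h3 : (t + 1) ^ s * (n - (u + 2 * s)).choose (k - (u + s)) ≤ starCard n k u :=
    (Nat.mul_le_mul_left _ h2).trans h1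
  rw [mul_comm]
  exact_mod_cast h3

/-! ### Families of walks of prescribed height -/

theorem uniformSets_eq (n k : ℕ) :
    uniformSets n k = Finset.powersetCard k (Finset.Ioc 0 (0 + n)) := by
  unfold uniformSets; congr 1; ext x; simp; omega

theorem card_le_choose_of_reach {n k u : ℕ} {A : Finset (Finset ℕ)} (hA : A ⊆ uniformSets n k)
    (hu : u ≤ k) (h : ∀ F ∈ A, Reach 0 u F) : A.card ≤ n.choose (k - u) := by
  classical
  refine le_trans (Finset.card_le_card ?_) (card_filter_reach_le n 0 (k - u) u)
  intro F hF
  rw [Finset.mem_filter, Nat.sub_add_cancel hu, ← uniformSets_eq]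
  exact ⟨hA hF, h F hF⟩

theorem card_le_of_reach {t n k u : ℕ} (ht : 0 < t) (hn : (t + 1) * k ≤ n)
    {A : Finset (Finset ℕ)} (hA : A ⊆ uniformSets n k)
    (hu : u ≤ k) (h : ∀ F ∈ A, Reach 0 u F) :
    (A.card : ℝ) ≤ (((t : ℝ) + 1) / t) ^ u * starCard n k u :=
  le_trans (by exact_mod_cast card_le_choose_of_reach hA hu h) (choose_sub_le ht hn hu)

theorem card_le_of_reach_not_touchOnce {t n k u : ℕ} (ht : 0 < t) (hn : (t + 1) * k ≤ n)
    {A : Finset (Finset ℕ)} (hA : A ⊆ uniformSets n k)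
    (hu : u ≤ k) (h : ∀ F ∈ A, Reach 0 u F ∧ ¬ TouchOnce 0 u F) :
    (A.card : ℝ) ≤ 2 / ((t : ℝ) + 1) * ((((t : ℝ) + 1) / t) ^ u * starCard n k u) := by
  classical
  rcases hu.eq_or_lt with rfl | hlt
  · have : A = ∅ := by
      by_contra hne
      obtain ⟨F, hF⟩ := Finset.nonempty_iff_ne_empty.2 hne
      exact (h F hF).2 ((h F hF).1.touchOnce (card_of_mem_uniformSets (hA hF)))
    rw [this, Finset.card_empty, Nat.cast_zero]
    positivity
  · obtain ⟨K, hK⟩ : ∃ K, k = K + 1 + u := ⟨k - u - 1, by omega⟩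
    have hkn : k ≤ n := by nlinarith
    obtain ⟨N, hN⟩ : ∃ N, n = N + 1 := ⟨n - 1, by omega⟩
    have h1 : A.card ≤ 2 * N.choose K := by
      refine le_trans (Finset.card_le_card ?_) (card_filter_reach_not_touchOnce_le N 0 K u)
      intro F hF
      rw [Finset.mem_filter, ← hK, ← hN, ← uniformSets_eq]
      exact ⟨hA hF, h F hF⟩
    have h2 : (t + 1) * N.choose K ≤ n.choose (k - u) := by
      have := pow_mul_choose_sub_le (t := t) (N := n) (K := k - u) (s := 1)
        (le_trans (Nat.mul_le_mul_left _ (Nat.sub_le _ _)) hn) (by omega)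
      rwa [pow_one, show n - 1 = N by omega, show k - u - 1 = K by omega] at this
    have h3 := choose_sub_le ht hn hu
    have h2' : ((t : ℝ) + 1) * N.choose K ≤ n.choose (k - u) := by exact_mod_cast h2
    have h1' : (A.card : ℝ) ≤ 2 * N.choose K := by exact_mod_cast h1
    rw [div_mul_eq_mul_div, le_div_iff₀ (by positivity)]
    nlinarith

theorem card_le_of_reach_succ {t n k u : ℕ} (ht : 0 < t) (hn : (t + 1) * k ≤ n)
    {A : Finset (Finset ℕ)} (hA : A ⊆ uniformSets n k) (hu : u ≤ k)
    (h : ∀ F ∈ A, Reach 0 (u + 1) F) :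
    (A.card : ℝ) ≤ (((t : ℝ) + 1) / t) ^ u / t * starCard n k u := by
  rcases hu.eq_or_lt with rfl | hlt
  · have : A = ∅ := by
      by_contra hne
      obtain ⟨F, hF⟩ := Finset.nonempty_iff_ne_empty.2 hne
      have := (h F hF).le_card
      rw [card_of_mem_uniformSets (hA hF)] at this
      omega
    rw [this, Finset.card_empty, Nat.cast_zero]
    positivity
  · exact le_trans (by exact_mod_cast card_le_choose_of_reach hA hlt h)
      (choose_sub_succ_le ht hn hlt)

/-- A walk that is at its maximal level `u` at time `m + 1` has stepped up at this time. -/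
theorem mem_of_not_reach {u m : ℕ} {F : Finset ℕ} (h : ¬ Reach 0 (u + 1) F)
    (hm : 2 * pre F (m + 1) = m + 1 + u) : m + 1 ∈ F := by
  by_contra hF
  have := pre_succ F m
  rw [if_neg hF] at this
  exact h (reach_zero_iff.2 ⟨m, by omega⟩)

/-- If all members of a family that do not exceed level `u` are at level `u` at the same time
`u + 2 * s`, the family is small. -/
theorem card_le_of_reach_or_eq {t n k u s : ℕ} (ht : 0 < t) (hn : (t + 1) * k ≤ n)
    {A : Finset (Finset ℕ)} (hA : A ⊆ uniformSets n k) (hu : u ≤ k) (hus : 0 < u + s)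
    (h : ∀ F ∈ A, Reach 0 (u + 1) F ∨ 2 * pre F (u + 2 * s) = u + 2 * s + u) :
    (A.card : ℝ) ≤ ((((t : ℝ) + 1) / t) ^ u / t +
      ((u + 2 * s - 1).choose s : ℝ) / ((t : ℝ) + 1) ^ s) * starCard n k u := by
  classical
  have h1 := card_le_of_reach_succ ht hn (A := A.filter (Reach 0 (u + 1)))
    ((Finset.filter_subset _ _).trans hA) hu (fun F hF => (Finset.mem_filter.1 hF).2)
  have h2 : ((A.filter fun F => ¬ Reach 0 (u + 1) F).card : ℝ) ≤
      ((u + 2 * s - 1).choose s : ℝ) / ((t : ℝ) + 1) ^ s * starCard n k u := by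
    by_cases hk : u + s ≤ k
    · obtain ⟨m, hm⟩ : ∃ m, u + 2 * s = m + 1 := ⟨u + 2 * s - 1, by omega⟩
      have h3 : (A.filter fun F => ¬ Reach 0 (u + 1) F).card ≤
          m.choose (u + s - 1) * (n - (m + 1)).choose (k - (u + s - 1 + 1)) := by
        refine le_trans (Finset.card_le_card ?_) (card_filter_pre_eq_mem_le n k m (u + s - 1))
        intro F hF
        obtain ⟨hF, hr⟩ := Finset.mem_filter.1 hF
        have h4 := (h F hF).resolve_left hr
        rw [hm] at h4
        exact Finset.mem_filter.2 ⟨hA hF, by omega, mem_of_not_reach hr (by omega)⟩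
      rw [← hm, show u + s - 1 + 1 = u + s by omega, show m = u + 2 * s - 1 by omega,
        ← Nat.choose_symm (by omega : u + s - 1 ≤ u + 2 * s - 1),
        show u + 2 * s - 1 - (u + s - 1) = s by omega] at h3
      have h5 := choose_sub_two_mul_le (t := t) hn hk
      calc _ ≤ ((u + 2 * s - 1).choose s : ℝ) *
              ((n - (u + 2 * s)).choose (k - (u + s)) : ℝ) := by exact_mod_cast h3
        _ ≤ ((u + 2 * s - 1).choose s : ℝ) * (starCard n k u / ((t : ℝ) + 1) ^ s) := by gcongr
        _ = _ := by ring
    · rw [Finset.filter_false_of_mem, Finset.card_empty, Nat.cast_zero]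
      · positivity
      · intro F hF hr
        have h4 := (h F hF).resolve_left hr
        have h5 := pre_le_card F (u + 2 * s)
        rw [card_of_mem_uniformSets (hA hF)] at h5
        omega
  have h3 := Finset.card_filter_add_card_filter_not (s := A) (Reach 0 (u + 1))
  have h4 : (A.card : ℝ) = ((A.filter (Reach 0 (u + 1))).card : ℝ) +
      ((A.filter fun F => ¬ Reach 0 (u + 1) F).card : ℝ) := by
    rw [← h3]; push_cast; ring
  rw [h4, add_mul]
  exact add_le_add h1 h2

/-! ### Numerical estimates -/

theorem div_pow_le_exp {t : ℕ} (ht : 0 < t) {j : ℕ} {c : ℝ} (hc : (j : ℝ) ≤ c * t) :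
    (((t : ℝ) + 1) / t) ^ j ≤ Real.exp c := by
  have ht' : (0 : ℝ) < t := by exact_mod_cast ht
  have h1 : ((t : ℝ) + 1) / t ≤ Real.exp (1 / t) := by
    have := Real.add_one_le_exp (1 / (t : ℝ))
    rw [add_div, div_self ht'.ne']; linarith
  calc (((t : ℝ) + 1) / t) ^ j ≤ Real.exp (1 / t) ^ j := by gcongr
    _ = Real.exp (j * (1 / t)) := by rw [← Real.exp_nat_mul]
    _ ≤ Real.exp c := by
      apply Real.exp_le_exp.2
      rw [mul_one_div, div_le_iff₀ ht']; exact hc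

theorem exp_le_of_pow {a b : ℕ} (hb : b ≠ 0) {x : ℝ} (hx : 0 ≤ x)
    (h : (2.7182818286 : ℝ) ^ a ≤ x ^ b) : Real.exp ((a : ℝ) / b) ≤ x := by
  refine le_of_pow_le_pow_left₀ hb hx ?_
  rw [← Real.exp_nat_mul, mul_div_cancel₀ _ (by exact_mod_cast hb : (b : ℝ) ≠ 0)]
  refine le_trans ?_ h
  rw [← mul_one (a : ℝ), Real.exp_nat_mul]
  exact pow_le_pow_left₀ (Real.exp_pos 1).le Real.exp_one_lt_d9.le a

theorem div_pow_two_mul_le {t : ℕ} (ht : 14 ≤ t) :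
    (((t : ℝ) + 1) / t) ^ (2 * t) ≤ 7.3891 := by
  refine (div_pow_le_exp (c := ((2 : ℕ) : ℝ) / (1 : ℕ)) (by omega) ?_).trans
    (exp_le_of_pow one_ne_zero (by norm_num) (by norm_num))
  push_cast; linarith

theorem div_pow_self_le {t : ℕ} (ht : 14 ≤ t) : (((t : ℝ) + 1) / t) ^ t ≤ 2.7183 := by
  refine (div_pow_le_exp (c := ((1 : ℕ) : ℝ) / (1 : ℕ)) (by omega) ?_).trans
    (exp_le_of_pow one_ne_zero (by norm_num) (by norm_num))
  push_cast; linarith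

theorem div_pow_add_three_le {t : ℕ} (ht : 14 ≤ t) : (((t : ℝ) + 1) / t) ^ (t + 3) ≤ 3.37 := by
  have : (14 : ℝ) ≤ t := by exact_mod_cast ht
  refine (div_pow_le_exp (c := ((17 : ℕ) : ℝ) / (14 : ℕ)) (by omega) ?_).trans
    (exp_le_of_pow (by norm_num) (by norm_num) (by norm_num))
  push_cast; linarith

theorem div_pow_add_four_le {t : ℕ} (ht : 14 ≤ t) : (((t : ℝ) + 1) / t) ^ (t + 4) ≤ 3.62 := by
  have : (14 : ℝ) ≤ t := by exact_mod_cast ht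
  refine (div_pow_le_exp (c := ((9 : ℕ) : ℝ) / (7 : ℕ)) (by omega) ?_).trans
    (exp_le_of_pow (by norm_num) (by norm_num) (by norm_num))
  push_cast; linarith

theorem one_le_succ_div {t : ℕ} (ht : 0 < t) : (1 : ℝ) ≤ ((t : ℝ) + 1) / t := by
  have ht' : (0 : ℝ) < t := by exact_mod_cast ht
  rw [le_div_iff₀ ht']; linarith

theorem cast_choose_two' (n : ℕ) : ((n + 2).choose 2 : ℝ) = (n + 2) * (n + 1) / 2 := by
  have := Nat.descFactorial_eq_factorial_mul_choose (n + 2) 2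
  simp [Nat.descFactorial, Nat.factorial] at this
  have := congrArg (Nat.cast (R := ℝ)) this
  push_cast at this
  linarith

theorem cast_choose_three' (n : ℕ) :
    ((n + 3).choose 3 : ℝ) = (n + 3) * (n + 2) * (n + 1) / 6 := by
  have := Nat.descFactorial_eq_factorial_mul_choose (n + 3) 3
  simp [Nat.descFactorial, Nat.factorial] at this
  have := congrArg (Nat.cast (R := ℝ)) this
  push_cast at this
  linarith

theorem cast_choose_four' (n : ℕ) :
    ((n + 4).choose 4 : ℝ) = (n + 4) * (n + 3) * (n + 2) * (n + 1) / 24 := by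
  have := Nat.descFactorial_eq_factorial_mul_choose (n + 4) 4
  simp [Nat.descFactorial, Nat.factorial] at this
  have := congrArg (Nat.cast (R := ℝ)) this
  push_cast at this
  linarith

theorem choose_add_two_mul (m s : ℕ) :
    (m + 2).choose (s + 1) * ((s + 1) * (m + 1 - s)) = m.choose s * ((m + 2) * (m + 1)) := by
  have h1 := Nat.add_one_mul_choose_eq (m + 1) s
  have h2 := Nat.choose_mul_succ_eq m s
  calc _ = ((m + 1 + 1).choose (s + 1) * (s + 1)) * (m + 1 - s) := by ring
    _ = (m + 2) * ((m + 1).choose s * (m + 1 - s)) := by rw [← h1]; ring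
    _ = _ := by rw [← h2]; ring

/-- The left side decreases in `s` from `s = 4` on. -/
theorem choose_div_pow_mul_le {t s : ℕ} (ht : 14 ≤ t) (hs : 4 ≤ s) :
    ((t + 2 * s - 1).choose s : ℝ) / ((t : ℝ) + 1) ^ s * (((t : ℝ) + 1) / t) ^ (t + s) ≤ 0.43 := by
  have ht0 : (0 : ℝ) < t := by exact_mod_cast (by omega : 0 < t)
  induction s, hs using Nat.le_induction with
  | base =>
    have h1 := div_pow_add_four_le ht
    have h2 : ((t + 2 * 4 - 1).choose 4 : ℝ) / ((t : ℝ) + 1) ^ 4 ≤ 0.11823 := by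
      rw [show t + 2 * 4 - 1 = t + 3 + 4 by omega, cast_choose_four',
        div_le_iff₀ (by positivity)]
      obtain ⟨x, rfl⟩ := Nat.exists_eq_add_of_le ht
      have hx : (0 : ℝ) ≤ x := Nat.cast_nonneg x
      push_cast
      have h2 : (0:ℝ) ≤ x ^ 2 := by positivity
      have h3 : (0:ℝ) ≤ x ^ 3 := by positivity
      have h4 : (0:ℝ) ≤ x ^ 4 := by positivity
      ring_nf
      linarith
    calc _ ≤ (0.11823 : ℝ) * 3.62 := mul_le_mul h2 h1 (by positivity) (by norm_num)
      _ ≤ _ := by norm_num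
  | succ s hs ih =>
    refine le_trans ?_ ih
    have h1 := choose_add_two_mul (t + 2 * s - 1) s
    rw [show t + 2 * s - 1 + 2 = t + 2 * (s + 1) - 1 by omega,
      show t + 2 * s - 1 + 1 = t + 2 * s by omega, show t + 2 * s - s = t + s by omega,
      show t + 2 * (s + 1) - 1 = t + 2 * s + 1 by omega] at h1
    have h2 : (t + 2 * s + 1) * (t + 2 * s) ≤ t * ((s + 1) * (t + s)) := by
      obtain ⟨x, rfl⟩ := Nat.exists_eq_add_of_le ht
      obtain ⟨y, rfl⟩ := Nat.exists_eq_add_of_le hs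
      nlinarith [Nat.zero_le (x * y), Nat.zero_le (x * x * y), Nat.zero_le (x * y * y)]
    have h3 : (t + 2 * s + 1).choose (s + 1) ≤ t * (t + 2 * s - 1).choose s := by
      refine Nat.le_of_mul_le_mul_right ?_ (show 0 < (s + 1) * (t + s) by positivity)
      rw [h1]
      calc _ ≤ (t + 2 * s - 1).choose s * (t * ((s + 1) * (t + s))) := Nat.mul_le_mul_left _ h2
        _ = _ := by ring
    rw [show t + 2 * (s + 1) - 1 = t + 2 * s + 1 by omega]
    have h4 : ((t + 2 * s + 1).choose (s + 1) : ℝ) ≤ t * (t + 2 * s - 1).choose s := by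
      exact_mod_cast h3
    calc _ ≤ t * ((t + 2 * s - 1).choose s : ℝ) / ((t : ℝ) + 1) ^ (s + 1) *
            (((t : ℝ) + 1) / t) ^ (t + (s + 1)) := by gcongr
      _ = _ := by
        rw [← add_assoc, pow_succ _ s, pow_succ _ (t + s)]
        field_simp

theorem card_mul_card_le {t n k u v : ℕ} {a b α β κ : ℝ} (hn : (t + 1) * k ≤ n) (hu : u ≤ k)
    (hv : v ≤ k) (huv : u + v = 2 * t) (hb : 0 ≤ b)
    (hα : 0 ≤ α) (h1 : a ≤ α * starCard n k u) (h2 : b ≤ β * starCard n k v) (h : α * β ≤ κ)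
    (hκ : 0 ≤ κ) : a * b ≤ κ * (starCard n k t : ℝ) ^ 2 := by
  have h3 := pow_mul_starCard_mul_starCard_le (x := 0) hn hu hv huv
  rw [pow_zero, one_mul] at h3
  have h3' : (starCard n k u : ℝ) * starCard n k v ≤ (starCard n k t : ℝ) ^ 2 := by
    exact_mod_cast h3
  calc a * b ≤ (α * starCard n k u) * (β * starCard n k v) := by
        apply mul_le_mul h1 h2 hb (by positivity)
    _ = α * β * (starCard n k u * starCard n k v) := by ring
    _ ≤ κ * (starCard n k u * starCard n k v) := by gcongr
    _ ≤ _ := by gcongr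

/-- The size estimate for two families whose members of minimal height `t - (s - s')`,
respectively `t + (s - s')`, are at this level simultaneously, not very early. -/
theorem card_mul_card_le_of_two_le {t n k s s' : ℕ} (ht : 14 ≤ t) (hn : (t + 1) * k ≤ n)
    (hs : 2 ≤ s) (hss : s' ≤ s) (hst : s ≤ t + s') {A B : Finset (Finset ℕ)}
    (hA : A ⊆ uniformSets n k) (hB : B ⊆ uniformSets n k)
    (hu : t + s' - s ≤ k) (hv : t + s - s' ≤ k)
    (hA' : ∀ F ∈ A, Reach 0 (t + s' - s + 1) F ∨
      2 * pre F (t + s + s') = t + s + s' + (t + s' - s))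
    (hBr : ∀ F ∈ B, Reach 0 (t + s - s') F)
    (hB' : ∀ F ∈ B, Reach 0 (t + s - s' + 1) F ∨
      2 * pre F (t + s + s') = t + s + s' + (t + s - s')) :
    (A.card : ℝ) * B.card ≤ 0.96 * (starCard n k t : ℝ) ^ 2 := by
  have ht0 : 0 < t := by omega
  have ht1 : (0 : ℝ) < t := by exact_mod_cast ht0
  have ht14 : (14 : ℝ) ≤ t := by exact_mod_cast ht
  have hE := one_le_succ_div ht0
  have hA1 := card_le_of_reach_or_eq (u := t + s' - s) (s := s) ht0 hn hA hu (by omega) (by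
    rw [show t + s' - s + 2 * s = t + s + s' by omega]; exact hA')
  rw [show t + s' - s + 2 * s = t + s + s' by omega] at hA1
  have hEu : (((t : ℝ) + 1) / t) ^ (t + s' - s) ≤ 2.7183 :=
    (pow_le_pow_right₀ hE (by omega)).trans (div_pow_self_le ht)
  rcases Nat.lt_or_ge s 4 with h4 | h4
  · have hB1 := card_le_of_reach_or_eq (u := t + s - s') (s := s') ht0 hn hB hv (by omega) (by
      rw [show t + s - s' + 2 * s' = t + s + s' by omega]; exact hB')
    rw [show t + s - s' + 2 * s' = t + s + s' by omega] at hB1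
    have hEv : (((t : ℝ) + 1) / t) ^ (t + s - s') ≤ 3.37 :=
      (pow_le_pow_right₀ hE (by omega)).trans (div_pow_add_three_le ht)
    have hα : (((t : ℝ) + 1) / t) ^ (t + s' - s) / t ≤ 0.1942 := by
      rw [div_le_iff₀ ht1]; linarith
    have hβ : (((t : ℝ) + 1) / t) ^ (t + s - s') / t ≤ 0.2408 := by
      rw [div_le_iff₀ ht1]; linarith
    have key : ∃ x y : ℝ, ((t + s + s' - 1).choose s : ℝ) / ((t : ℝ) + 1) ^ s ≤ x ∧
        ((t + s + s' - 1).choose s' : ℝ) / ((t : ℝ) + 1) ^ s' ≤ y ∧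
        (0.1942 + x) * (0.2408 + y) ≤ 0.96 := by
      obtain ⟨x, hx⟩ := Nat.exists_eq_add_of_le ht
      have hx0 : (0 : ℝ) ≤ x := Nat.cast_nonneg x
      have hx2 : (0 : ℝ) ≤ x ^ 2 := by positivity
      have hx3 : (0 : ℝ) ≤ x ^ 3 := by positivity
      have hxt : (t : ℝ) = 14 + x := by rw [hx]; push_cast; ring
      interval_cases s
      · interval_cases s'
        · refine ⟨0.5, 1, ?_, by simp, by norm_num⟩
          rw [show t + 2 + 0 - 1 = (t - 1) + 2 by omega, cast_choose_two',
            div_le_iff₀ (by positivity), Nat.cast_sub (by omega), hxt]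
          push_cast; ring_nf; linarith
        · refine ⟨0.5334, 1.0667, ?_, ?_, by norm_num⟩
          · rw [show t + 2 + 1 - 1 = t + 2 by omega, cast_choose_two',
              div_le_iff₀ (by positivity), hxt]
            ring_nf; linarith
          · rw [show t + 2 + 1 - 1 = t + 2 by omega, Nat.choose_one_right,
              div_le_iff₀ (by positivity)]
            push_cast; rw [hxt]; ring_nf; linarith
        · have h : ((t + 2 + 2 - 1).choose 2 : ℝ) / ((t : ℝ) + 1) ^ 2 ≤ 0.6045 := by
            rw [show t + 2 + 2 - 1 = (t + 1) + 2 by omega, cast_choose_two',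
              div_le_iff₀ (by positivity)]
            push_cast; rw [hxt]; ring_nf; linarith
          exact ⟨_, _, h, h, by norm_num⟩
      · refine ⟨0.2872, 1.134, ?_, ?_, by norm_num⟩
        · have h1 : ((t + 3 + s' - 1).choose 3 : ℝ) ≤ ((t + 2 + 3).choose 3 : ℝ) := by
            exact_mod_cast Nat.choose_le_choose 3 (by omega)
          rw [cast_choose_three'] at h1
          rw [div_le_iff₀ (by positivity)]
          refine h1.trans ?_
          push_cast; rw [hxt]; ring_nf; linarith
        · interval_cases s'
          · norm_num
          · rw [show t + 3 + 1 - 1 = t + 3 by omega, Nat.choose_one_right,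
              div_le_iff₀ (by positivity)]
            push_cast; rw [hxt]; ring_nf; linarith
          · rw [show t + 3 + 2 - 1 = (t + 2) + 2 by omega, cast_choose_two',
              div_le_iff₀ (by positivity)]
            push_cast; rw [hxt]; ring_nf; linarith
          · rw [show t + 3 + 3 - 1 = (t + 2) + 3 by omega, cast_choose_three',
              div_le_iff₀ (by positivity)]
            push_cast; rw [hxt]; ring_nf; linarith
    obtain ⟨x, y, hx, hy, hxy⟩ := key
    refine card_mul_card_le hn hu hv (by omega) (by positivity) (by positivity) hA1 hB1 ?_
      (by norm_num)
    refine le_trans (mul_le_mul (add_le_add hα hx) (add_le_add hβ hy) (by positivity) ?_) hxy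
    have : (0 : ℝ) ≤ ((t + s + s' - 1).choose s : ℝ) / ((t : ℝ) + 1) ^ s := by positivity
    linarith
  · have hB1 := card_le_of_reach ht0 hn hB hv hBr
    refine card_mul_card_le hn hu hv (by omega) (by positivity) (by positivity) hA1 hB1 ?_
      (by norm_num)
    have h1 : ((t + s + s' - 1).choose s : ℝ) ≤ ((t + 2 * s - 1).choose s : ℝ) := by
      exact_mod_cast Nat.choose_le_choose s (by omega)
    have h2 : (((t : ℝ) + 1) / t) ^ (t + s - s') ≤ (((t : ℝ) + 1) / t) ^ (t + s) :=
      pow_le_pow_right₀ hE (by omega)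
    have h3 := choose_div_pow_mul_le ht h4
    have h5 : (((t : ℝ) + 1) / t) ^ (t + s' - s) * (((t : ℝ) + 1) / t) ^ (t + s - s') ≤
        7.3891 := by
      rw [← pow_add, show t + s' - s + (t + s - s') = 2 * t by omega]
      exact div_pow_two_mul_le ht
    have h6 : (((t : ℝ) + 1) / t) ^ (t + s' - s) / t * (((t : ℝ) + 1) / t) ^ (t + s - s') ≤
        0.5279 := by
      rw [div_mul_eq_mul_div, div_le_iff₀ ht1]; linarith
    have h7 : ((t + s + s' - 1).choose s : ℝ) / ((t : ℝ) + 1) ^ s *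
        (((t : ℝ) + 1) / t) ^ (t + s - s') ≤ 0.43 := by
      refine le_trans ?_ h3
      gcongr
    rw [add_mul]
    linarith

/-! ### Initial-segment families and late walks -/

/-- The `k`-element subsets of `[n]` with at least `r` elements in `[m]`. -/
def initFamily (n k m r : ℕ) : Finset (Finset ℕ) :=
  (uniformSets n k).filter fun F => r ≤ pre F m

theorem frankl_eq (t s n k : ℕ) : frankl t s n k = initFamily n k (t + 2 * s) (t + s) := rfl

/-- The walk of `F` has maximal level `u`, and it is at this level at time `m` only. -/
def TouchAt (m u : ℕ) (F : Finset ℕ) : Prop :=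
  2 * pre F m = m + u ∧ ∀ m', m' ≠ m → 2 * pre F m' < m' + u

theorem touchOnce_zero_iff {u : ℕ} {F : Finset ℕ} : TouchOnce 0 u F ↔ ∃ m, TouchAt m u F := by
  simp only [TouchOnce, TouchAt, pre_eq]

/-- If a walk steps down `i` times after its only visit, at time `m`, to its maximal level,
a walk that is below the complementary level at time `m` must exceed this level after time
`m + i`. -/
theorem exists_late {t s s' i : ℕ} (hs : s ≤ 1) (ht : 1 ≤ t) {F G : Finset ℕ}
    (h : ∃ m, m + t ≤ pre F m + pre G m) (hF : pre F (t + s + s') < t + s')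
    (hG : TouchAt (t + s + s') (t + s - s') G)
    (hi : pre G (t + s + s' + i) = pre G (t + s + s')) (hs' : s' ≤ 1) :
    ∃ m, t + s + s' + i < m ∧ m + (t + s' - s + 1) ≤ 2 * pre F m := by
  obtain ⟨m, hm⟩ := h
  obtain ⟨hG1, hG2⟩ := hG
  have hne : m ≠ t + s + s' := by rintro rfl; omega
  have h1 := hG2 m hne
  have h2 := pre_le F m
  refine ⟨m, ?_, by omega⟩
  by_contra hlt
  rcases lt_or_ge m (t + s + s') with h3 | h3
  · have h4 := pre_mono F h3.le
    omega
  · obtain ⟨d, rfl⟩ := Nat.exists_eq_add_of_le h3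
    have h4 := pre_add_le F (t + s + s') d
    have h5 := pre_mono G (show t + s + s' + d ≤ t + s + s' + i by omega)
    omega

/-! ### The excess of one family -/

/-- A walk that is at level `u` or above after time `m₀` is at level exactly `u` at some later
time, since it finally goes down. -/
theorem exists_eq_of_exists_ge {n k m₀ u : ℕ} {F : Finset ℕ} (hF : F ∈ uniformSets n k)
    (h : ∃ m, m₀ < m ∧ m + u ≤ 2 * pre F m) : ∃ m, m₀ < m ∧ 2 * pre F m = m + u := by
  classical
  by_contra! hcon
  have hall : ∀ j, ∃ m, m₀ + j < m ∧ m + u ≤ 2 * pre F m := by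
    intro j
    induction j with
    | zero => simpa using h
    | succ j ih =>
      obtain ⟨m, h1, h2⟩ := ih
      have h3 := hcon m (by omega)
      have h4 := pre_mono F (show m ≤ m + 1 by omega)
      exact ⟨m + 1, by omega, by omega⟩
  obtain ⟨m, h1, h2⟩ := hall (2 * k)
  have := pre_le_card F m
  rw [card_of_mem_uniformSets hF] at this
  omega

theorem choose_add_le_mul {t s s' l : ℕ} (ht : 2 ≤ t) (hs : s ≤ 1) (hs' : s' ≤ 1) (hl : 1 ≤ l) :
    (t + s + s' + 1 + 2 * l).choose (s + l) ≤
      (t + s + s').choose s * (t + 2 + 2 * l).choose l := by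
  interval_cases s
  · simp only [Nat.choose_zero_right, one_mul, zero_add, add_zero]
    exact Nat.choose_le_choose _ (by omega)
  · rw [Nat.choose_one_right]
    refine Nat.le_of_mul_le_mul_right ?_ (show 0 < l + 1 by omega)
    have h1 := Nat.add_one_mul_choose_eq (t + 1 + s' + 2 * l) l
    rw [show t + 1 + s' + 1 + 2 * l = t + 1 + s' + 2 * l + 1 by ring, add_comm 1 l, ← h1]
    have h2 : (t + 1 + s' + 2 * l).choose l ≤ (t + 2 + 2 * l).choose l :=
      Nat.choose_le_choose _ (by omega)
    have h3 : t + 1 + s' + 2 * l + 1 ≤ (t + 1 + s') * (l + 1) := by nlinarith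
    calc _ ≤ ((t + 1 + s') * (l + 1)) * (t + 2 + 2 * l).choose l := Nat.mul_le_mul h3 h2
      _ = _ := by ring

/-- An upper bound, relative to the reference family, for the number of walks that exceed the
critical level at the `l`-th possible time. -/
noncomputable def lateWeight (t l : ℕ) : ℝ :=
  ((t + 2 + 2 * l).choose l : ℝ) / ((t : ℝ) + 1) ^ (l + 1)

theorem lateWeight_nonneg (t l : ℕ) : 0 ≤ lateWeight t l := by unfold lateWeight; positivity

theorem lateWeight_succ_le {t l : ℕ} (ht : 14 ≤ t) (hl : 1 ≤ l) :
    lateWeight t (l + 1) ≤ 3 / 4 * lateWeight t l := by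
  have h1 := choose_add_two_mul (t + 2 + 2 * l) l
  rw [show t + 2 + 2 * l + 1 - l = t + 3 + l by omega] at h1
  have h2 : 4 * ((t + 2 + 2 * l + 2) * (t + 2 + 2 * l + 1)) ≤
      3 * (t + 1) * ((l + 1) * (t + 3 + l)) := by
    obtain ⟨x, rfl⟩ := Nat.exists_eq_add_of_le ht
    obtain ⟨y, rfl⟩ := Nat.exists_eq_add_of_le hl
    nlinarith [Nat.zero_le (x * y), Nat.zero_le (x * x * y), Nat.zero_le (x * y * y)]
  have h3 : 4 * (t + 2 + 2 * l + 2).choose (l + 1) ≤ 3 * (t + 1) * (t + 2 + 2 * l).choose l := by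
    refine Nat.le_of_mul_le_mul_right ?_ (show 0 < (l + 1) * (t + 3 + l) by positivity)
    calc _ = 4 * ((t + 2 + 2 * l + 2).choose (l + 1) * ((l + 1) * (t + 3 + l))) := by ring
      _ = (t + 2 + 2 * l).choose l * (4 * ((t + 2 + 2 * l + 2) * (t + 2 + 2 * l + 1))) := by
        rw [h1]; ring
      _ ≤ (t + 2 + 2 * l).choose l * (3 * (t + 1) * ((l + 1) * (t + 3 + l))) :=
        Nat.mul_le_mul_left _ h2
      _ = _ := by ring
  have h3' : 4 * ((t + 2 + 2 * l + 2).choose (l + 1) : ℝ) ≤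
      3 * (t + 1) * (t + 2 + 2 * l).choose l := by exact_mod_cast h3
  unfold lateWeight
  rw [show t + 2 + 2 * (l + 1) = t + 2 + 2 * l + 2 by ring, div_le_iff₀ (by positivity),
    pow_succ _ (l + 1)]
  have : (3 : ℝ) / 4 * (((t + 2 + 2 * l).choose l : ℝ) / ((t : ℝ) + 1) ^ (l + 1)) *
      (((t : ℝ) + 1) ^ (l + 1) * ((t : ℝ) + 1)) =
      3 / 4 * ((t + 1) * (t + 2 + 2 * l).choose l) := by
    field_simp
  rw [this]
  linarith

theorem lateWeight_one_le {t : ℕ} (ht : 14 ≤ t) : lateWeight t 1 ≤ 0.08 := by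
  unfold lateWeight
  rw [div_le_iff₀ (by positivity), Nat.choose_one_right]
  obtain ⟨x, rfl⟩ := Nat.exists_eq_add_of_le ht
  have hx : (0 : ℝ) ≤ x := Nat.cast_nonneg x
  push_cast
  nlinarith

theorem lateWeight_le {t : ℕ} (ht : 14 ≤ t) (l : ℕ) :
    lateWeight t (l + 1) ≤ 0.08 * (3 / 4) ^ l := by
  induction l with
  | zero => simpa using lateWeight_one_le ht
  | succ l ih =>
    have := lateWeight_succ_le ht (show 1 ≤ l + 1 by omega)
    rw [pow_succ]; linarith

/-- The weights decay geometrically with ratio at most `3 / 4`. -/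
theorem sum_lateWeight_le {t : ℕ} (ht : 14 ≤ t) (l N : ℕ) :
    ∑ j ∈ Finset.Ico (l + 1) N, lateWeight t j ≤ 0.32 * (3 / 4) ^ l := by
  have h0 : (0 : ℝ) ≤ 0.32 * (3 / 4) ^ l := by positivity
  rcases le_total N (l + 1) with h | h
  · rw [Finset.Ico_eq_empty_of_le h, Finset.sum_empty]; exact h0
  · have key : ∑ j ∈ Finset.Ico (l + 1) N, lateWeight t j + 4 * lateWeight t N ≤
        4 * lateWeight t (l + 1) := by
      induction N, h using Nat.le_induction with
      | base => simp
      | succ N hN ih =>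
        rw [Finset.sum_Ico_succ_top hN]
        have := lateWeight_succ_le ht (show 1 ≤ N by omega)
        linarith
    have h1 := lateWeight_le ht l
    have h2 := lateWeight_nonneg t N
    linarith

theorem choose_mul_choose_le_card_initFamily {n k m s : ℕ} (hm : m ≤ n) (hs : s ≤ m)
    (hk : m - s ≤ k) :
    m.choose s * (n - m).choose (k - (m - s)) ≤ (initFamily n k m (m - s)).card := by
  rw [← Nat.choose_symm hs]
  refine (choose_mul_choose_le_card_filter_pre_eq hm hk).trans (Finset.card_le_card ?_)
  intro F hF
  rw [Finset.mem_filter] at hF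
  exact Finset.mem_filter.2 ⟨hF.1, hF.2.ge⟩

/-- Few walks exceed the critical level late. -/
theorem card_le_of_late {t n k s s' l : ℕ} (ht : 14 ≤ t) (hn : (t + 1) * k ≤ n) (hs : s ≤ 1)
    (hs' : s' ≤ 1) (hk : t + s' ≤ k) {S : Finset (Finset ℕ)} (hS : S ⊆ uniformSets n k)
    (h : ∀ F ∈ S, ∃ m, t + s + s' + 2 * l + 1 < m ∧ m + (t + s' - s + 1) ≤ 2 * pre F m) :
    (S.card : ℝ) ≤ 0.32 * (3 / 4) ^ l * (initFamily n k (t + s + s') (t + s')).card := by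
  classical
  have hkn : 15 * k ≤ n := le_trans (Nat.mul_le_mul_right _ (by omega)) hn
  have hW := choose_mul_choose_le_card_initFamily (n := n) (k := k) (m := t + s + s') (s := s)
    (by omega) (by omega) (by omega)
  rw [show t + s + s' - s = t + s' by omega] at hW
  have hterm : ∀ j ∈ Finset.Ico (l + 1) k,
      (((uniformSets n k).filter fun F => pre F (t + s + s' + 1 + 2 * j) =
        t + s' + 1 + j).card : ℝ) ≤
      lateWeight t j * (initFamily n k (t + s + s') (t + s')).card := by
    intro j hj
    rw [Finset.mem_Ico] at hj
    by_cases hjk : t + s' + 1 + j ≤ k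
    · have h1 := card_filter_pre_eq_le n k (t + s + s' + 1 + 2 * j) (t + s' + 1 + j)
      rw [← Nat.choose_symm (by omega : t + s' + 1 + j ≤ t + s + s' + 1 + 2 * j),
        show t + s + s' + 1 + 2 * j - (t + s' + 1 + j) = s + j by omega] at h1
      have h2 := choose_add_le_mul (t := t) (by omega) hs hs' (show 1 ≤ j by omega)
      have h3 : (t + 1) ^ (j + 1) *
          (n - (t + s + s' + 1 + 2 * j)).choose (k - (t + s' + 1 + j)) ≤
          (n - (t + s + s')).choose (k - (t + s')) := by
        have h4 : (t + 1) * (k - (t + s')) ≤ n - (t + s + s') := by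
          have : (t + 1) * (k - (t + s')) + (t + 1) * (t + s') = (t + 1) * k := by
            rw [← mul_add]; congr 1; omega
          have : t + s + s' ≤ (t + 1) * (t + s') := by nlinarith
          omega
        refine le_trans (Nat.mul_le_mul_left _ ?_)
          (pow_mul_choose_sub_le h4 (s := j + 1) (by omega))
        rw [show k - (t + s' + 1 + j) = k - (t + s') - (j + 1) by omega]
        exact Nat.choose_le_choose _ (by omega)
      unfold lateWeight
      rw [div_mul_eq_mul_div, le_div_iff₀ (by positivity)]
      have h5 : ((uniformSets n k).filter fun F => pre F (t + s + s' + 1 + 2 * j) =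
          t + s' + 1 + j).card * (t + 1) ^ (j + 1) ≤
          (t + 2 + 2 * j).choose j * (initFamily n k (t + s + s') (t + s')).card := by
        calc _ ≤ ((t + s + s' + 1 + 2 * j).choose (s + j) *
              (n - (t + s + s' + 1 + 2 * j)).choose (k - (t + s' + 1 + j))) *
              (t + 1) ^ (j + 1) := Nat.mul_le_mul_right _ h1
          _ = (t + s + s' + 1 + 2 * j).choose (s + j) * ((t + 1) ^ (j + 1) *
              (n - (t + s + s' + 1 + 2 * j)).choose (k - (t + s' + 1 + j))) := by ring
          _ ≤ ((t + s + s').choose s * (t + 2 + 2 * j).choose j) *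
              (n - (t + s + s')).choose (k - (t + s')) := Nat.mul_le_mul h2 h3
          _ = (t + 2 + 2 * j).choose j * ((t + s + s').choose s *
              (n - (t + s + s')).choose (k - (t + s'))) := by ring
          _ ≤ _ := Nat.mul_le_mul_left _ hW
      exact_mod_cast h5
    · rw [Finset.filter_false_of_mem, Finset.card_empty, Nat.cast_zero]
      · exact mul_nonneg (lateWeight_nonneg _ _) (Nat.cast_nonneg _)
      · intro F hF he
        have := pre_le_card F (t + s + s' + 1 + 2 * j)
        rw [card_of_mem_uniformSets hF] at this
        omega
  have hcover : S ⊆ (Finset.Ico (l + 1) k).biUnion fun j =>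
      (uniformSets n k).filter fun F => pre F (t + s + s' + 1 + 2 * j) = t + s' + 1 + j := by
    intro F hF
    obtain ⟨m, h1, h2⟩ := exists_eq_of_exists_ge (hS hF) (h F hF)
    have h3 := pre_le_card F m
    rw [card_of_mem_uniformSets (hS hF)] at h3
    rw [Finset.mem_biUnion]
    refine ⟨pre F m - (t + s' + 1), Finset.mem_Ico.2 ⟨by omega, by omega⟩, ?_⟩
    rw [Finset.mem_filter]
    refine ⟨hS hF, ?_⟩
    rw [show t + s + s' + 1 + 2 * (pre F m - (t + s' + 1)) = m by omega]
    omega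
  calc (S.card : ℝ) ≤ ∑ j ∈ Finset.Ico (l + 1) k, (((uniformSets n k).filter fun F =>
          pre F (t + s + s' + 1 + 2 * j) = t + s' + 1 + j).card : ℝ) := by
        exact_mod_cast (Finset.card_le_card hcover).trans Finset.card_biUnion_le
    _ ≤ ∑ j ∈ Finset.Ico (l + 1) k,
          lateWeight t j * (initFamily n k (t + s + s') (t + s')).card :=
        Finset.sum_le_sum hterm
    _ = (∑ j ∈ Finset.Ico (l + 1) k, lateWeight t j) *
          (initFamily n k (t + s + s') (t + s')).card := by rw [Finset.sum_mul]
    _ ≤ _ := by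
        gcongr
        exact sum_lateWeight_le ht l k

/-! ### Walks that visit the critical level once -/

theorem card_initFamily_zero_le (n k m : ℕ) :
    (initFamily n k m m).card ≤ (n - m).choose (k - m) := by
  refine le_trans (Finset.card_le_card ?_) (le_trans (card_filter_pre_eq_le n k m m) ?_)
  · intro F hF
    obtain ⟨hF, h⟩ := Finset.mem_filter.1 hF
    have := pre_le F m
    exact Finset.mem_filter.2 ⟨hF, by omega⟩
  · simp

theorem card_initFamily_one_le (n k m : ℕ) :
    (initFamily n k (m + 1) m).card ≤ (m + 1) * (n - (m + 1)).choose (k - m) +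
      if m + 1 ≤ k then (n - (m + 1)).choose (k - (m + 1)) else 0 := by
  have h1 := card_filter_pre_eq_le n k (m + 1) m
  rw [Nat.choose_symm_of_eq_add (show m + 1 = m + 1 by rfl), Nat.choose_one_right] at h1
  have h2 : ((uniformSets n k).filter fun F => pre F (m + 1) = m + 1).card ≤
      if m + 1 ≤ k then (n - (m + 1)).choose (k - (m + 1)) else 0 := by
    split_ifs with h
    · refine (card_filter_pre_eq_le n k (m + 1) (m + 1)).trans ?_
      rw [Nat.choose_self, one_mul]
    · rw [Finset.filter_false_of_mem, Finset.card_empty]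
      intro F hF he
      have := pre_le_card F (m + 1)
      rw [card_of_mem_uniformSets hF] at this
      omega
  refine le_trans (Finset.card_le_card (t := ((uniformSets n k).filter fun F =>
    pre F (m + 1) = m) ∪ ((uniformSets n k).filter fun F => pre F (m + 1) = m + 1)) ?_)
    ((Finset.card_union_le _ _).trans (add_le_add h1 h2))
  intro F hF
  obtain ⟨hF, h⟩ := Finset.mem_filter.1 hF
  have := pre_le F (m + 1)
  rw [Finset.mem_union, Finset.mem_filter, Finset.mem_filter]
  have : pre F (m + 1) = m ∨ pre F (m + 1) = m + 1 := by omega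
  tauto

theorem card_initFamily_le {n k m s t : ℕ} (hs : s ≤ 1) (hm : 1 ≤ m) (hn : (t + 1) * k ≤ n)
    (ht : 1 ≤ t) :
    (initFamily n k m (m - s)).card ≤
      (if s = 0 then 1 else m + 1) * (n - m).choose (k - (m - s)) := by
  interval_cases s
  · simpa using card_initFamily_zero_le n k m
  · obtain ⟨m, rfl⟩ : ∃ m', m = m' + 1 := ⟨m - 1, by omega⟩
    rw [if_neg one_ne_zero, add_mul (m + 1), one_mul, Nat.add_sub_cancel]
    refine (card_initFamily_one_le n k m).trans (Nat.add_le_add_left ?_ _)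
    split_ifs with h
    · rw [show k - m = k - (m + 1) + 1 by omega]
      have := mul_choose_le_choose_succ (τ := 1) (N := n - (m + 1)) (K := k - (m + 1)) (by
        have : 2 * k ≤ n := le_trans (Nat.mul_le_mul_right _ (by omega)) hn
        omega)
      omega
    · exact Nat.zero_le _

/-- Initial segments of walks that reach their maximal level at time `m` for the first time,
after at most one step down. -/
theorem exists_initial_segments {m s : ℕ} (hs : s ≤ 1) (hm : 15 ≤ m ∨ s = 0) :
    ∃ P : Finset (Finset ℕ), (∀ p ∈ P, p ⊆ Finset.Icc 1 m ∧ p.card = m - s ∧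
      ∀ m' < m, 2 * pre p m' + 2 * s < m' + m) ∧
      13 * (if s = 0 then 1 else m + 1) ≤ 16 * P.card := by
  classical
  interval_cases s
  · refine ⟨{Finset.Icc 1 m}, ?_, by simp⟩
    intro p hp
    rw [Finset.mem_singleton] at hp
    subst hp
    refine ⟨subset_rfl, by simp, fun m' h => ?_⟩
    have := pre_le (Finset.Icc 1 m) m'
    omega
  · have hm : 15 ≤ m := by omega
    refine ⟨(Finset.Icc 1 (m - 2)).image fun x => (Finset.Icc 1 m).erase x, ?_, ?_⟩
    · intro p hp
      obtain ⟨x, hx, rfl⟩ := Finset.mem_image.1 hp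
      rw [Finset.mem_Icc] at hx
      refine ⟨Finset.erase_subset _ _, ?_, fun m' h => ?_⟩
      · rw [Finset.card_erase_of_mem (by rw [Finset.mem_Icc]; omega)]; simp
      · have h1 := pre_le ((Finset.Icc 1 m).erase x) m'
        by_cases hxm : x ≤ m'
        · have : pre ((Finset.Icc 1 m).erase x) m' + 1 ≤ m' := by
            unfold pre
            have hsub : (Finset.Icc 1 m).erase x ∩ Finset.Icc 1 m' ⊆ (Finset.Icc 1 m').erase x := by
              intro y; simp only [Finset.mem_inter, Finset.mem_erase]; tauto
            have := Finset.card_le_card hsub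
            rw [Finset.card_erase_of_mem (by rw [Finset.mem_Icc]; omega)] at this
            rw [Nat.card_Icc] at this
            omega
          omega
        · omega
    · rw [Finset.card_image_of_injOn]
      · simp; omega
      · intro x hx y hy he
        simp only [Finset.coe_Icc, Set.mem_Icc] at hx hy
        by_contra hne
        have h1 : x ∈ (Finset.Icc 1 m).erase y := by
          rw [Finset.mem_erase, Finset.mem_Icc]; omega
        have he' : (Finset.Icc 1 m).erase x = (Finset.Icc 1 m).erase y := he
        rw [← he'] at h1
        exact (Finset.mem_erase.1 h1).1 rfl

open Classical in
/-- Most walks do not climb to a positive level. -/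
theorem mul_choose_le_card_not_reach {τ a N K d : ℕ} (hd : 1 ≤ d) (h : (τ + 2) * K ≤ N + 1) :
    τ * N.choose K ≤ (τ + 1) * ((Finset.powersetCard K (Finset.Ioc a (a + N))).filter
      fun Q => ¬ Reach a d Q).card := by
  have h1 := Finset.card_filter_add_card_filter_not
    (s := Finset.powersetCard K (Finset.Ioc a (a + N))) (Reach a d)
  have h2 : (τ + 1) * ((Finset.powersetCard K (Finset.Ioc a (a + N))).filter (Reach a d)).card ≤
      N.choose K := by
    cases K with
    | zero =>
      rw [Finset.filter_false_of_mem, Finset.card_empty]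
      · simp
      · intro F hF hr
        have := hr.le_card
        rw [(Finset.mem_powersetCard.1 hF).2] at this
        omega
    | succ K =>
      refine le_trans (Nat.mul_le_mul_left _ ?_) (mul_choose_le_choose_succ (τ := τ + 1) (N := N)
        (K := K) ?_)
      · refine (Finset.card_le_card ?_).trans (card_filter_reach_le N a K 1)
        intro F hF
        rw [Finset.mem_filter] at hF ⊢
        exact ⟨hF.1, hF.2.mono hd⟩
      · have : (τ + 2) * (K + 1) = (τ + 1) * (K + 1) + (K + 1) := by ring
        omega
  rw [Finset.card_powersetCard] at h1
  simp only [Nat.card_Ioc, Nat.add_sub_cancel_left] at h1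
  nlinarith

open Classical in
/-- A fixed proportion of the reference family, up to a factor for each step, consists of walks
that visit the critical level once and step down `d` times after this visit. -/
theorem mul_card_initFamily_le_card_touchAt {t n k m s d : ℕ} (ht : 14 ≤ t)
    (hn : (t + 1) * k ≤ n) (hs : s ≤ 1) (hm : 15 ≤ m ∨ s = 0) (hm1 : 1 ≤ m) (hk : m - s ≤ k)
    (hd : 1 ≤ d) (hmd : m + d ≤ 2 * k) :
    143 / 192 * (12 / 13 : ℝ) ^ d * (initFamily n k m (m - s)).card ≤
      ((initFamily n k m (m - s)).filter fun F =>
        TouchAt m (m - 2 * s) F ∧ pre F (m + d) = pre F m).card := by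
  obtain ⟨P, hP, hPc⟩ := exists_initial_segments hs hm
  have hkn : 15 * k ≤ n := le_trans (Nat.mul_le_mul_right _ (by omega)) hn
  set K := k - (m - s) with hK
  obtain ⟨N, hN⟩ : ∃ N, n = m + d + N := ⟨n - (m + d), by omega⟩
  have hNK : (12 + 1) * K ≤ N + 1 := by omega
  set Q := (Finset.powersetCard K (Finset.Ioc (m + d) (m + d + N))).filter
    fun Q => ¬ Reach (m + d) d Q with hQ
  set T := (initFamily n k m (m - s)).filter fun F =>
        TouchAt m (m - 2 * s) F ∧ pre F (m + d) = pre F m with hT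
  have h1 : P.card * Q.card ≤ T.card := by
    refine card_mul_card_le_of_union_mem (X := Finset.Icc 1 m) (Y := Finset.Ioc (m + d) n) ?_
      (fun p hp => (hP p hp).1) ?_ ?_
    · rw [Finset.disjoint_left]; intro x; simp; omega
    · intro q hq
      have := (Finset.mem_powersetCard.1 (Finset.mem_filter.1 hq).1).1
      rwa [← hN] at this
    · intro p hp q hq
      obtain ⟨hp1, hp2, hp3⟩ := hP p hp
      obtain ⟨hq1, hq2⟩ := Finset.mem_filter.1 hq
      obtain ⟨hq3, hq4⟩ := Finset.mem_powersetCard.1 hq1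
      rw [← hN] at hq3
      have hd1 : Disjoint p q := by
        rw [Finset.disjoint_left]; intro x h1 h2
        have h1 := hp1 h1
        have h2 := hq3 h2
        simp at h1 h2; omega
      have hsum : ∀ m', pre (p ∪ q) m' = pre p m' + pre q m' := by
        intro m'
        rw [pre_add_pre, Finset.disjoint_iff_inter_eq_empty.1 hd1]
        simp [pre]
      have hp4 : ∀ m', m ≤ m' → pre p m' = m - s := by
        intro m' h
        unfold pre
        rw [Finset.inter_eq_left.2 (hp1.trans (Finset.Icc_subset_Icc_right h)), hp2]
      have hq5 : ∀ m', m' ≤ m + d → pre q m' = 0 := by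
        intro m' h
        unfold pre
        rw [Finset.card_eq_zero]
        ext x; simp; intro hx; have := hq3 hx; simp at this; omega
      have hq6 : ∀ e, 2 * pre q (m + d + e) < e + d := by
        intro e
        have : pre q (m + d + e) = (q ∩ Finset.Ioc (m + d) (m + d + e)).card := by
          unfold pre; congr 1; ext x
          simp only [Finset.mem_inter, Finset.mem_Icc, Finset.mem_Ioc]
          constructor
          · rintro ⟨hx, h⟩
            have := hq3 hx; simp at this; exact ⟨hx, by omega⟩
          · rintro ⟨hx, h⟩; exact ⟨hx, by omega⟩
        rw [this]
        by_contra hc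
        exact hq2 ⟨e, by omega⟩
      have hpm : pre (p ∪ q) m = m - s := by
        rw [hsum, hp4 m le_rfl, hq5 m (by omega), add_zero]
      rw [hT, Finset.mem_filter]
      refine ⟨Finset.mem_filter.2 ⟨Finset.mem_powersetCard.2 ⟨?_, ?_⟩, hpm.ge⟩, ⟨?_, ?_⟩, ?_⟩
      · intro x hx
        rcases Finset.mem_union.1 hx with h | h
        · have := hp1 h; simp at this ⊢; omega
        · have := hq3 h; simp at this ⊢; omega
      · rw [Finset.card_union_of_disjoint hd1, hp2, hq4]; omega
      · rw [hpm]; omega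
      · intro m' hne
        rw [hsum]
        rcases lt_or_gt_of_ne hne with h | h
        · have := hp3 m' h
          rw [hq5 m' (by omega)]; omega
        · rw [hp4 m' h.le]
          rcases le_total m' (m + d) with h' | h'
          · rw [hq5 m' h']; omega
          · obtain ⟨e, rfl⟩ := Nat.exists_eq_add_of_le h'
            have := hq6 e
            omega
      · rw [hpm, hsum, hp4 _ (by omega), hq5 _ le_rfl, add_zero]
  have h2 : 11 * N.choose K ≤ 12 * Q.card :=
    mul_choose_le_card_not_reach (τ := 11) (a := m + d) hd hNK
  have h3 := choose_add_le (τ := 12) (by norm_num) hNK d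
  have h4 := card_initFamily_le (t := t) hs hm1 hn (by omega)
  rw [← hK, show n - m = N + d by omega] at h4
  have h5 : 13 * (initFamily n k m (m - s)).card ≤ 16 * P.card * (N + d).choose K := by
    calc _ ≤ 13 * ((if s = 0 then 1 else m + 1) * (N + d).choose K) := Nat.mul_le_mul_left _ h4
      _ = 13 * (if s = 0 then 1 else m + 1) * (N + d).choose K := by ring
      _ ≤ _ := Nat.mul_le_mul_right _ hPc
  have h1' : (P.card : ℝ) * Q.card ≤ T.card := by exact_mod_cast h1
  have h2' : (11 : ℝ) * N.choose K ≤ 12 * Q.card := by exact_mod_cast h2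
  have h5' : (13 : ℝ) * (initFamily n k m (m - s)).card ≤ 16 * P.card * (N + d).choose K := by
    exact_mod_cast h5
  have h6 : (12 / 13 : ℝ) ^ d * (N + d).choose K ≤ N.choose K := by
    calc _ ≤ (12 / 13 : ℝ) ^ d * ((((12 : ℕ) : ℝ) + 1) / (12 : ℕ)) ^ d * (N.choose K : ℝ) := by
          rw [mul_assoc]; gcongr
      _ = N.choose K := by
          rw [← mul_pow]; norm_num
  calc 143 / 192 * (12 / 13 : ℝ) ^ d * (initFamily n k m (m - s)).card
      = 11 / 192 * (12 / 13 : ℝ) ^ d * (13 * (initFamily n k m (m - s)).card) := by ring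
    _ ≤ 11 / 192 * (12 / 13 : ℝ) ^ d * (16 * P.card * (N + d).choose K) := by gcongr
    _ = 11 / 12 * P.card * ((12 / 13 : ℝ) ^ d * (N + d).choose K) := by ring
    _ ≤ 11 / 12 * P.card * N.choose K := by gcongr
    _ = P.card * (11 * N.choose K) / 12 := by ring
    _ ≤ P.card * (12 * Q.card) / 12 := by gcongr
    _ = P.card * Q.card := by ring
    _ ≤ _ := h1'

/-- The part of `A` outside its reference family is smaller, in proportion, than the part of the
reference family of `B` that `B` misses. -/
theorem excess_le_deficit {t n k s s' : ℕ} (ht : 14 ≤ t) (hn : (t + 1) * k ≤ n) (hs : s ≤ 1)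
    (hs' : s' ≤ 1) {A B : Finset (Finset ℕ)} (hA : A ⊆ uniformSets n k)
    (hdual : ∀ F ∈ A, ∀ G ∈ B, ∃ m, m + t ≤ pre F m + pre G m)
    (hG : ∃ G ∈ B, TouchAt (t + s + s') (t + s - s') G) :
    ((A \ initFamily n k (t + s + s') (t + s')).card : ℝ) *
      (initFamily n k (t + s + s') (t + s)).card ≤
    2 / 3 * (initFamily n k (t + s + s') (t + s) \ B).card *
      (initFamily n k (t + s + s') (t + s')).card := by
  classical
  rcases (A \ initFamily n k (t + s + s') (t + s')).eq_empty_or_nonempty with h0 | ⟨F₀, hF₀⟩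
  · rw [h0]; simp; positivity
  have hout : ∀ F ∈ A \ initFamily n k (t + s + s') (t + s'),
      F ∈ A ∧ pre F (t + s + s') < t + s' := by
    intro F hF
    rw [Finset.mem_sdiff] at hF
    refine ⟨hF.1, ?_⟩
    by_contra hc
    exact hF.2 (Finset.mem_filter.2 ⟨hA hF.1, by omega⟩)
  -- The largest number `i` of steps for which some member of `B` steps down after its only visit.
  have hlate : ∀ i, (∃ G ∈ B, TouchAt (t + s + s') (t + s - s') G ∧
      pre G (t + s + s' + i) = pre G (t + s + s')) →
      ∀ F ∈ A \ initFamily n k (t + s + s') (t + s'),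
        ∃ m, t + s + s' + i < m ∧ m + (t + s' - s + 1) ≤ 2 * pre F m := by
    rintro i ⟨G, hG, h1, h2⟩ F hF
    obtain ⟨hF1, hF2⟩ := hout F hF
    exact exists_late hs (by omega) (hdual F hF1 G hG) hF2 h1 h2 hs'
  have hbound : ∀ i, (∃ G ∈ B, TouchAt (t + s + s') (t + s - s') G ∧
      pre G (t + s + s' + i) = pre G (t + s + s')) → 2 * t + 2 * s' + i + 2 ≤ 2 * k := by
    intro i hi
    obtain ⟨m, h1, h2⟩ := hlate i hi F₀ hF₀
    have := pre_le_card F₀ m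
    rw [card_of_mem_uniformSets (hA (hout F₀ hF₀).1)] at this
    omega
  obtain ⟨i, hi1, hi2, hi3⟩ : ∃ i, 1 ≤ i ∧ (∃ G ∈ B, TouchAt (t + s + s') (t + s - s') G ∧
      pre G (t + s + s' + i) = pre G (t + s + s')) ∧ ¬ (∃ G ∈ B,
      TouchAt (t + s + s') (t + s - s') G ∧
      pre G (t + s + s' + (i + 1)) = pre G (t + s + s')) := by
    by_contra! hcon
    have hall : ∀ i, ∃ G ∈ B, TouchAt (t + s + s') (t + s - s') G ∧
        pre G (t + s + s' + (i + 1)) = pre G (t + s + s') := by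
      intro i
      induction i with
      | zero =>
        -- A walk steps down directly after a visit to its maximal level.
        obtain ⟨G, hG, h1⟩ := hG
        refine ⟨G, hG, h1, ?_⟩
        have h2 := h1.2 (t + s + s' + (0 + 1)) (by omega)
        have h3 := pre_mono G (show t + s + s' ≤ t + s + s' + (0 + 1) by omega)
        have h4 := h1.1
        omega
      | succ i ih => exact hcon (i + 1) (by omega) ih
    have := hbound _ (hall (2 * k))
    omega
  have hki := hbound i hi2
  -- Level `u + 1` is only reached at times of one parity, so two values of `i` share a bound.
  obtain ⟨l, hl⟩ : ∃ l, i = 2 * l + 1 ∨ i = 2 * l + 2 := ⟨(i - 1) / 2, by omega⟩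
  have hexc := card_le_of_late (l := l) ht hn hs hs' (by omega)
    (Finset.sdiff_subset.trans hA) (S := A \ initFamily n k (t + s + s') (t + s')) (by
      intro F hF
      obtain ⟨m, h1, h2⟩ := hlate i hi2 F hF
      exact ⟨m, by omega, h2⟩)
  have hdef := mul_card_initFamily_le_card_touchAt (m := t + s + s') (s := s') (d := i + 1) ht hn
    hs' (by omega) (by omega) (by omega) (by omega) (by omega)
  rw [show t + s + s' - s' = t + s by omega, show t + s + s' - 2 * s' = t + s - s' by omega] at hdef
  have hsub : ((initFamily n k (t + s + s') (t + s)).filter fun F =>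
        TouchAt (t + s + s') (t + s - s') F ∧
        pre F (t + s + s' + (i + 1)) = pre F (t + s + s')) ⊆
      initFamily n k (t + s + s') (t + s) \ B := by
    intro F hF
    obtain ⟨h1, h2, h3⟩ := Finset.mem_filter.1 hF
    exact Finset.mem_sdiff.2 ⟨h1, fun hFB => hi3 ⟨F, hFB, h2, h3⟩⟩
  have hdef' := hdef.trans (Nat.cast_le.2 (Finset.card_le_card hsub))
  -- The factor `0.48 = 0.32 * 3 / 2` leaves room for the constant `2 / 3` in the conclusion.
  have hpow : (0.48 : ℝ) * (3 / 4) ^ l ≤ 143 / 192 * (12 / 13 : ℝ) ^ (i + 1) := by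
    calc (0.48 : ℝ) * (3 / 4) ^ l ≤ 143 / 192 * (12 / 13 : ℝ) ^ 3 * ((12 / 13) ^ 2) ^ l := by
          gcongr <;> norm_num
      _ = 143 / 192 * (12 / 13 : ℝ) ^ (2 * l + 3) := by rw [← pow_mul]; ring
      _ ≤ _ := by
          gcongr ?_ * ?_
          exact pow_le_pow_of_le_one (by norm_num) (by norm_num) (by omega)
  set a := ((initFamily n k (t + s + s') (t + s')).card : ℝ)
  set b := ((initFamily n k (t + s + s') (t + s)).card : ℝ)
  have ha : 0 ≤ a := Nat.cast_nonneg _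
  have hb : 0 ≤ b := Nat.cast_nonneg _
  calc _ ≤ (0.32 * (3 / 4) ^ l * a) * b := by gcongr
    _ = 2 / 3 * (0.48 * (3 / 4) ^ l * b) * a := by ring
    _ ≤ 2 / 3 * (143 / 192 * (12 / 13 : ℝ) ^ (i + 1) * b) * a := by gcongr
    _ ≤ _ := by gcongr

/-! ### Comparison with the reference families -/

theorem card_sub_card_eq {A F : Finset (Finset ℕ)} :
    (A.card : ℝ) = F.card + (A \ F).card - (F \ A).card := by
  have h1 := Finset.card_sdiff_add_card A F
  have h2 := Finset.card_sdiff_add_card F A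
  rw [Finset.union_comm] at h2
  have h3 : ((A \ F).card : ℝ) + F.card = (F \ A).card + A.card := by
    exact_mod_cast h1.trans h2.symm
  linarith

theorem card_symmDiff_eq (A F : Finset (Finset ℕ)) :
    ((symmDiff A F).card : ℝ) = (A \ F).card + (F \ A).card := by
  have : Disjoint (A \ F) (F \ A) := by
    rw [Finset.disjoint_left]; intro x; simp; tauto
  have h : symmDiff A F = (A \ F) ∪ (F \ A) := rfl
  rw [h, Finset.card_union_of_disjoint this]; push_cast; ring

/-- Two families with members that are at their minimal level only at the same early time are,
on average of the relative sizes, no larger than their reference families, with stability. -/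
theorem card_mul_add_card_mul_le {t n k s s' : ℕ} (ht : 14 ≤ t) (hn : (t + 1) * k ≤ n)
    (hs : s ≤ 1) (hs' : s' ≤ 1) {A B : Finset (Finset ℕ)} (hA : A ⊆ uniformSets n k)
    (hB : B ⊆ uniformSets n k)
    (hdual : ∀ F ∈ A, ∀ G ∈ B, ∃ m, m + t ≤ pre F m + pre G m)
    (hF : ∃ F ∈ A, TouchAt (t + s + s') (t + s' - s) F)
    (hG : ∃ G ∈ B, TouchAt (t + s + s') (t + s - s') G) :
    (A.card : ℝ) * (initFamily n k (t + s + s') (t + s)).card +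
      B.card * (initFamily n k (t + s + s') (t + s')).card ≤
    2 * (initFamily n k (t + s + s') (t + s')).card * (initFamily n k (t + s + s') (t + s)).card -
      1 / 5 * ((symmDiff A (initFamily n k (t + s + s') (t + s'))).card *
          (initFamily n k (t + s + s') (t + s)).card +
        (symmDiff B (initFamily n k (t + s + s') (t + s))).card *
          (initFamily n k (t + s + s') (t + s')).card) := by
  have h1 := excess_le_deficit ht hn hs hs' hA hdual hG
  have h2 := excess_le_deficit (s := s') (s' := s) ht hn hs' hs hB
    (fun G hG F hF => (hdual F hF G hG).imp fun m hm => by omega)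
    (by rwa [add_right_comm t s' s])
  rw [add_right_comm t s' s] at h2
  rw [card_symmDiff_eq, card_symmDiff_eq,
    card_sub_card_eq (A := A) (F := initFamily n k (t + s + s') (t + s')),
    card_sub_card_eq (A := B) (F := initFamily n k (t + s + s') (t + s))]
  linarith

theorem mem_initFamily_of_touchAt {n k m r u : ℕ} {F : Finset ℕ} (hF : F ∈ uniformSets n k)
    (h : TouchAt m u F) (hr : 2 * r = m + u) : F ∈ initFamily n k m r := by
  have := h.1
  exact Finset.mem_filter.2 ⟨hF, by omega⟩

theorem card_add_card_le_frankl {t n k s : ℕ} (ht : 14 ≤ t) (hn : (t + 1) * k ≤ n)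
    (hs : s ≤ 1) {A B : Finset (Finset ℕ)} (hA : A ⊆ uniformSets n k)
    (hB : B ⊆ uniformSets n k)
    (hdual : ∀ F ∈ A, ∀ G ∈ B, ∃ m, m + t ≤ pre F m + pre G m)
    (hF : ∃ F ∈ A, TouchAt (t + 2 * s) t F) (hG : ∃ G ∈ B, TouchAt (t + 2 * s) t G) :
    (A.card : ℝ) + B.card ≤ 2 * (frankl t s n k).card -
      1 / 5 * ((symmDiff A (frankl t s n k)).card + (symmDiff B (frankl t s n k)).card) ∧
      0 < (frankl t s n k).card := by
  have hpos : 0 < (frankl t s n k).card := by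
    obtain ⟨F, hFA, h⟩ := hF
    exact Finset.card_pos.2 ⟨F, frankl_eq t s n k ▸ mem_initFamily_of_touchAt (hA hFA) h (by ring)⟩
  refine ⟨?_, hpos⟩
  have h := card_mul_add_card_mul_le (s := s) (s' := s) ht hn hs hs hA hB hdual
  rw [Nat.add_sub_cancel, add_assoc, ← two_mul, ← frankl_eq] at h
  have h1 := h hF hG
  have hpos' : (0 : ℝ) < (frankl t s n k).card := by exact_mod_cast hpos
  refine le_of_mul_le_mul_right ?_ hpos'
  linarith

/-- A family without a walk that visits level `t` only at time `t + 2 * s` misses at least half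
of the family `frankl t s n k`. -/
theorem two_mul_card_inter_frankl_le {t n k s : ℕ} (ht : 14 ≤ t) (hn : (t + 1) * k ≤ n)
    (hs : s ≤ 1) {A : Finset (Finset ℕ)}
    (hF : ¬ ∃ F ∈ A, TouchAt (t + 2 * s) t F) :
    2 * ((A ∩ frankl t s n k).card : ℝ) ≤ (frankl t s n k).card := by
  classical
  by_cases hk : t + s ≤ k
  · have h1 := mul_card_initFamily_le_card_touchAt (m := t + 2 * s) (s := s) (d := 1) ht hn hs
      (by omega) (by omega) (by omega) le_rfl (by omega)
    rw [show t + 2 * s - s = t + s by omega, show t + 2 * s - 2 * s = t by omega,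
      ← frankl_eq] at h1
    have h2 : ((frankl t s n k).filter fun F => TouchAt (t + 2 * s) t F ∧
        pre F (t + 2 * s + 1) = pre F (t + 2 * s)) ⊆ frankl t s n k \ A := by
      intro F h
      obtain ⟨h3, h4, -⟩ := Finset.mem_filter.1 h
      exact Finset.mem_sdiff.2 ⟨h3, fun h5 => hF ⟨F, h5, h4⟩⟩
    have h3 : ((frankl t s n k \ A).card : ℝ) + (A ∩ frankl t s n k).card =
        (frankl t s n k).card := by
      rw [Finset.inter_comm]
      exact_mod_cast Finset.card_sdiff_add_card_inter (frankl t s n k) A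
    have h4 := h1.trans (Nat.cast_le.2 (Finset.card_le_card h2))
    have h5 : (0 : ℝ) ≤ (frankl t s n k).card := Nat.cast_nonneg _
    linarith
  · have : frankl t s n k = ∅ := by
      rw [frankl_eq, Finset.eq_empty_iff_forall_notMem]
      intro F hF
      obtain ⟨h1, h2⟩ := Finset.mem_filter.1 hF
      have := pre_le_card F (t + 2 * s)
      rw [card_of_mem_uniformSets h1] at this
      omega
    rw [this]; simp

theorem card_frankl_le {t n k s : ℕ} (ht : 1 ≤ t) (hn : (t + 1) * k ≤ n) (hs : s ≤ 1)
    (hk : t + s ≤ k) : (frankl t s n k).card ≤ (n - t).choose (k - t) := by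
  rw [frankl_eq]
  interval_cases s
  · exact card_initFamily_zero_le n k t
  · refine (card_initFamily_one_le n k (t + 1)).trans ?_
    have hkn : 2 * k ≤ n := le_trans (Nat.mul_le_mul_right _ (by omega)) hn
    obtain ⟨N, hN⟩ : ∃ N, n = N + (t + 2) := ⟨n - (t + 2), by omega⟩
    obtain ⟨K, hK⟩ : ∃ K, k = K + (t + 1) := ⟨k - (t + 1), by omega⟩
    have h1 : t * N.choose K ≤ N.choose (K + 1) := by
      refine mul_choose_le_choose_succ ?_
      have : (t + 1) * k = t * (K + 1) + t * t + k := by rw [hK]; ring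
      have : t ≤ t * t := by nlinarith
      omega
    rw [show n - (t + 1 + 1) = N by omega, show n - t = N + 1 + 1 by omega,
      show k - (t + 1) = K by omega, show k - t = K + 1 by omega, Nat.choose_succ_succ',
      Nat.choose_succ_succ' N K]
    cases K with
    | zero =>
      rw [if_neg (by omega)]
      simp at h1 ⊢; omega
    | succ K =>
      rw [if_pos (by omega), show k - (t + 1 + 1) = K by omega, Nat.choose_succ_succ' N K]
      nlinarith

/-- The product for the two reference families of levels `t - 1` and `t + 1`. -/
theorem card_initFamily_mul_le {t n k : ℕ} (ht : 1 ≤ t) (hn : (t + 1) * k ≤ n)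
    (hk : t + 1 ≤ k) :
    ((initFamily n k (t + 1) t).card : ℝ) * (initFamily n k (t + 1) (t + 1)).card ≤
      (1 - t / ((t : ℝ) + 1) ^ 2) * (starCard n k t : ℝ) ^ 2 := by
  have h1 := card_initFamily_one_le n k t
  rw [if_pos hk] at h1
  have h2 := card_initFamily_zero_le n k (t + 1)
  have h3 := pow_mul_starCard_add_le (s := 1) hn hk
  have hkn : 2 * k ≤ n := le_trans (Nat.mul_le_mul_right _ (by omega)) hn
  have h4 : starCard n k t = (n - (t + 1)).choose (k - (t + 1)) + (n - (t + 1)).choose (k - t) := by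
    unfold starCard
    rw [show n - t = n - (t + 1) + 1 by omega, show k - t = k - (t + 1) + 1 by omega,
      Nat.choose_succ_succ']
  rw [pow_one, starCard] at h3
  have h1' : ((initFamily n k (t + 1) t).card : ℝ) ≤ (t + 1) * (n - (t + 1)).choose (k - t) +
    (n - (t + 1)).choose (k - (t + 1)) := by exact_mod_cast h1
  have h2' : ((initFamily n k (t + 1) (t + 1)).card : ℝ) ≤
    (n - (t + 1)).choose (k - (t + 1)) := by exact_mod_cast h2
  have h3' : ((t : ℝ) + 1) * (n - (t + 1)).choose (k - (t + 1)) ≤ starCard n k t := by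
    exact_mod_cast h3
  have h4' : (starCard n k t : ℝ) = (n - (t + 1)).choose (k - (t + 1)) +
    (n - (t + 1)).choose (k - t) := by exact_mod_cast h4
  set x : ℝ := ((n - (t + 1)).choose (k - (t + 1)) : ℝ)
  set y : ℝ := ((n - (t + 1)).choose (k - t) : ℝ)
  set M : ℝ := (starCard n k t : ℝ)
  have hx : 0 ≤ x := Nat.cast_nonneg _
  have hM : 0 ≤ M := Nat.cast_nonneg _
  have ht' : (1 : ℝ) ≤ t := by exact_mod_cast ht
  have hT : (0 : ℝ) < ((t : ℝ) + 1) ^ 2 := by positivity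
  have hz : x = ((t + 1) * x) / (t + 1) := by field_simp
  set z : ℝ := (t + 1) * x with hzdef
  have hz0 : 0 ≤ z := by positivity
  have hc : (t : ℝ) / (t + 1) ^ 2 ≤ 1 / 2 := by
    rw [div_le_iff₀ hT]; nlinarith
  have hc0 : (0 : ℝ) ≤ t / (t + 1) ^ 2 := by positivity
  calc _ ≤ ((t + 1) * y + x) * x :=
        mul_le_mul h1' h2' (Nat.cast_nonneg _) (by positivity)
    _ = M * z - t / (t + 1) ^ 2 * z ^ 2 := by
        rw [show y = M - x by linarith, hzdef]; field_simp; ring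
    _ ≤ (1 - t / ((t : ℝ) + 1) ^ 2) * M ^ 2 := by
        have : 0 ≤ (M - z) * (M - t / (t + 1) ^ 2 * (M + z)) := by
          refine mul_nonneg (by linarith) ?_
          nlinarith
        nlinarith

theorem mul_le_mul_of_mul_add_mul_le {a b x y : ℝ} (ha : 0 < a) (hb : 0 < b) (hx : 0 ≤ x)
    (hy : 0 ≤ y) (h : x * b + y * a ≤ 2 * a * b) : x * y ≤ a * b := by
  have hab : 0 < a * b := mul_pos ha hb
  have h1 : (x * b) * (y * a) ≤ (a * b) * (a * b) := by
    have h2 : 0 ≤ x * b := by positivity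
    have h3 : 0 ≤ y * a := by positivity
    nlinarith [sq_nonneg (x * b - y * a)]
  refine le_of_mul_le_mul_right ?_ hab
  linarith

/-! ### The general bound -/

/-- The smallest height of the members of a family exists and is at most `k`. -/
theorem exists_min_reach {n k : ℕ} {A : Finset (Finset ℕ)} (hA : A ⊆ uniformSets n k)
    (hne : A.Nonempty) :
    ∃ u ≤ k, (∀ F ∈ A, Reach 0 u F) ∧ ∃ F ∈ A, ¬ Reach 0 (u + 1) F := by
  obtain ⟨F₀, hF₀⟩ := hne
  have hle : ∀ u, (∀ F ∈ A, Reach 0 u F) → u ≤ k := fun u hu => by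
    have := (hu F₀ hF₀).le_card
    rwa [card_of_mem_uniformSets (hA hF₀)] at this
  by_contra! hcon
  have hall : ∀ u, ∀ F ∈ A, Reach 0 u F := by
    intro u
    induction u with
    | zero => exact fun F _ => reach_zero 0 F
    | succ u ih => exact hcon u (hle u ih) ih
  have := hle (k + 1) (hall _)
  omega

theorem two_mul_pre_le {u : ℕ} {F : Finset ℕ} (h : ¬ Reach 0 (u + 1) F) (m : ℕ) :
    2 * pre F m ≤ m + u := by
  by_contra hc
  exact h (reach_zero_iff.2 ⟨m, by omega⟩)

theorem TouchAt.two_mul_pre_le {m₀ u : ℕ} {F : Finset ℕ} (h : TouchAt m₀ u F) (m : ℕ) :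
    2 * pre F m ≤ m + u := by
  by_cases hm : m = m₀
  · rw [hm, h.1]
  · exact (h.2 m hm).le

/-- The case in which the minimal heights sum to more than `2 * t`. -/
theorem card_mul_card_le_of_lt {t n k u v : ℕ} (ht : 14 ≤ t) (hn : (t + 1) * k ≤ n)
    {A B : Finset (Finset ℕ)} (hA : A ⊆ uniformSets n k) (hB : B ⊆ uniformSets n k)
    (hu : u ≤ k) (hv : v ≤ k) (huv : 2 * t < u + v) (hAu : ∀ F ∈ A, Reach 0 u F)
    (hBv : ∀ F ∈ B, Reach 0 v F) :
    (A.card : ℝ) * B.card ≤ 0.99 * (starCard n k t : ℝ) ^ 2 := by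
  have ht0 : 0 < t := by omega
  have ht1 : (0 : ℝ) < t := by exact_mod_cast ht0
  have ht14 : (14 : ℝ) ≤ t := by exact_mod_cast ht
  obtain ⟨x, hx⟩ := Nat.exists_eq_add_of_lt huv
  have h1 := card_le_of_reach ht0 hn hA hu hAu
  have h2 := card_le_of_reach ht0 hn hB hv hBv
  have h3 := pow_mul_starCard_mul_starCard_le (x := x + 1) hn hu hv (by omega)
  have h3' : ((t : ℝ) + 1) ^ (x + 1) * ((starCard n k u : ℝ) * starCard n k v) ≤
      (starCard n k t : ℝ) ^ 2 := by exact_mod_cast h3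
  have h4 := div_pow_two_mul_le ht
  have h5 : (1 / (t : ℝ)) ^ (x + 1) ≤ 1 / 14 := by
    calc (1 / (t : ℝ)) ^ (x + 1) ≤ (1 / (t : ℝ)) ^ 1 :=
          pow_le_pow_of_le_one (by positivity) (by rw [div_le_one ht1]; linarith) (by omega)
      _ ≤ 1 / 14 := by rw [pow_one]; gcongr
  calc (A.card : ℝ) * B.card ≤ ((((t : ℝ) + 1) / t) ^ u * starCard n k u) *
        ((((t : ℝ) + 1) / t) ^ v * starCard n k v) :=
        mul_le_mul h1 h2 (Nat.cast_nonneg _) (by positivity)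
    _ = (((t : ℝ) + 1) / t) ^ (u + v) * (starCard n k u * starCard n k v) := by
        rw [pow_add]; ring
    _ = (((t : ℝ) + 1) / t) ^ (2 * t) * (1 / (t : ℝ)) ^ (x + 1) *
        (((t : ℝ) + 1) ^ (x + 1) * (starCard n k u * starCard n k v)) := by
        rw [show u + v = 2 * t + (x + 1) by omega, pow_add, div_pow _ _ (x + 1), one_div, inv_pow]
        field_simp
    _ ≤ 7.3891 * (1 / 14) * (starCard n k t : ℝ) ^ 2 := by gcongr
    _ ≤ _ := by gcongr; norm_num

/-- The case in which no member of `A` touches the minimal level exactly once. -/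
theorem card_mul_card_le_of_not_touchOnce {t n k u v : ℕ} (ht : 14 ≤ t) (hn : (t + 1) * k ≤ n)
    {A B : Finset (Finset ℕ)} (hA : A ⊆ uniformSets n k) (hB : B ⊆ uniformSets n k)
    (hu : u ≤ k) (hv : v ≤ k) (huv : u + v = 2 * t)
    (hAu : ∀ F ∈ A, Reach 0 u F ∧ ¬ TouchOnce 0 u F) (hBv : ∀ F ∈ B, Reach 0 v F) :
    (A.card : ℝ) * B.card ≤ 0.99 * (starCard n k t : ℝ) ^ 2 := by
  have ht0 : 0 < t := by omega
  have ht14 : (14 : ℝ) ≤ t := by exact_mod_cast ht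
  have h1 := card_le_of_reach_not_touchOnce ht0 hn hA hu hAu
  rw [← mul_assoc] at h1
  refine card_mul_card_le hn hu hv huv (Nat.cast_nonneg _) (by positivity) h1
    (card_le_of_reach ht0 hn hB hv hBv) ?_ (by norm_num)
  rw [mul_assoc, ← pow_add, huv, div_mul_eq_mul_div, div_le_iff₀ (by positivity)]
  have := div_pow_two_mul_le ht
  linarith

theorem ninety_nine_hundredths_le {t : ℕ} (ht : 14 ≤ t) :
    (0.99 : ℝ) ≤ 1 - 1 / (10 * ((t : ℝ) + 1)) := by
  have ht14 : (14 : ℝ) ≤ t := by exact_mod_cast ht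
  have : 1 / (10 * ((t : ℝ) + 1)) ≤ 0.01 := by
    rw [div_le_iff₀ (by positivity)]; linarith
  linarith

/-- The bound when members of both families are at their minimal level at one time only, which
is then common to all members of minimal height, and is not that of the reference families
`frankl t 0 n k` and `frankl t 1 n k`. -/
theorem card_mul_card_le_of_touchAt {t n k s s' : ℕ} (ht : 14 ≤ t) (hn : (t + 1) * k ≤ n)
    {A B : Finset (Finset ℕ)} (hA : A ⊆ uniformSets n k) (hB : B ⊆ uniformSets n k)
    (hdual : ∀ F ∈ A, ∀ G ∈ B, ∃ m, m + t ≤ pre F m + pre G m)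
    (hst : s ≤ t + s') (hst' : s' ≤ t + s)
    (hu : t + s' - s ≤ k) (hv : t + s - s' ≤ k)
    (hAr : ∀ F ∈ A, Reach 0 (t + s' - s) F) (hBr : ∀ F ∈ B, Reach 0 (t + s - s') F)
    (hF : ∃ F ∈ A, TouchAt (t + s + s') (t + s' - s) F)
    (hG : ∃ G ∈ B, TouchAt (t + s + s') (t + s - s') G)
    (hA' : ∀ F ∈ A, Reach 0 (t + s' - s + 1) F ∨
      2 * pre F (t + s + s') = t + s + s' + (t + s' - s))
    (hB' : ∀ F ∈ B, Reach 0 (t + s - s' + 1) F ∨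
      2 * pre F (t + s + s') = t + s + s' + (t + s - s'))
    (hne : ¬ (s = s' ∧ s ≤ 1)) :
    (A.card : ℝ) * B.card ≤ (1 - 1 / (10 * ((t : ℝ) + 1))) * (starCard n k t : ℝ) ^ 2 := by
  wlog hss : s' ≤ s generalizing s s' A B
  · rw [mul_comm (A.card : ℝ)]
    rw [add_right_comm t s s'] at *
    exact this hB hA (fun G hG F hF => (hdual F hF G hG).imp fun m hm => by omega) hst' hst hv hu
      hBr hAr hG hF hB' hA' (by omega) (by omega)
  have ht14 : (14 : ℝ) ≤ t := by exact_mod_cast ht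
  rcases Nat.lt_or_ge s 2 with h2 | h2
  · obtain ⟨rfl, rfl⟩ : s = 1 ∧ s' = 0 := by omega
    have h := card_mul_add_card_mul_le ht hn (s := 1) (s' := 0) le_rfl (by omega) hA hB hdual hF hG
    obtain ⟨F, hFA, hF⟩ := hF
    obtain ⟨G, hGB, hG⟩ := hG
    have ha := Finset.card_pos.2 ⟨F, mem_initFamily_of_touchAt (r := t) (hA hFA) hF (by omega)⟩
    have hb := Finset.card_pos.2 ⟨G, mem_initFamily_of_touchAt (r := t + 1) (hB hGB) hG (by omega)⟩
    simp only [add_zero] at h ha hb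
    have h3 := mul_le_mul_of_mul_add_mul_le (a := ((initFamily n k (t + 1) t).card : ℝ))
      (b := ((initFamily n k (t + 1) (t + 1)).card : ℝ)) (x := (A.card : ℝ)) (y := (B.card : ℝ))
      (by exact_mod_cast ha) (by exact_mod_cast hb) (Nat.cast_nonneg _) (Nat.cast_nonneg _)
      (h.trans (sub_le_self _ (by positivity)))
    refine h3.trans ((card_initFamily_mul_le (by omega) hn (by omega)).trans ?_)
    gcongr (1 - ?_) * _
    rw [div_le_div_iff₀ (by positivity) (by positivity)]
    nlinarith
  · refine (card_mul_card_le_of_two_le ht hn h2 hss hst hA hB hu hv hA' hBr hB').trans ?_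
    gcongr
    exact le_trans (by norm_num) (ninety_nine_hundredths_le ht)

/-- Unless both families contain walks that touch level `t` once at the critical time of
`frankl t 0 n k`, or both at that of `frankl t 1 n k`, the product of the sizes is smaller than
the square of the size of a star by a factor depending on `t`. -/
theorem card_mul_card_le_of_not_touchAt {t n k : ℕ} (ht : 14 ≤ t) (hn : (t + 1) * k ≤ n)
    {A B : Finset (Finset ℕ)} (hA : A ⊆ uniformSets n k) (hB : B ⊆ uniformSets n k)
    (hdual : ∀ F ∈ A, ∀ G ∈ B, ∃ m, m + t ≤ pre F m + pre G m)
    (hAne : A.Nonempty) (hBne : B.Nonempty)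
    (hne : ∀ s ≤ 1, ¬ ((∃ F ∈ A, TouchAt (t + 2 * s) t F) ∧ ∃ G ∈ B, TouchAt (t + 2 * s) t G)) :
    (A.card : ℝ) * B.card ≤ (1 - 1 / (10 * ((t : ℝ) + 1))) * (starCard n k t : ℝ) ^ 2 := by
  have ht14 : (14 : ℝ) ≤ t := by exact_mod_cast ht
  have hconst : (0.99 : ℝ) * (starCard n k t : ℝ) ^ 2 ≤
      (1 - 1 / (10 * ((t : ℝ) + 1))) * (starCard n k t : ℝ) ^ 2 := by
    gcongr
    exact ninety_nine_hundredths_le ht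
  obtain ⟨u, hu, hAr, F₀, hF₀, hF₀'⟩ := exists_min_reach hA hAne
  obtain ⟨v, hv, hBr, G₀, hG₀, hG₀'⟩ := exists_min_reach hB hBne
  have huv : 2 * t ≤ u + v := by
    obtain ⟨m, hm⟩ := hdual F₀ hF₀ G₀ hG₀
    have := two_mul_pre_le hF₀' m
    have := two_mul_pre_le hG₀' m
    omega
  rcases huv.lt_or_eq with hlt | heq
  · exact (card_mul_card_le_of_lt ht hn hA hB hu hv hlt hAr hBr).trans hconst
  by_cases hAt : ∃ F ∈ A, TouchOnce 0 u F
  swap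
  · push Not at hAt
    exact (card_mul_card_le_of_not_touchOnce ht hn hA hB hu hv heq.symm
      (fun F hF => ⟨hAr F hF, hAt F hF⟩) hBr).trans hconst
  by_cases hBt : ∃ F ∈ B, TouchOnce 0 v F
  swap
  · push Not at hBt
    rw [mul_comm (A.card : ℝ)]
    exact (card_mul_card_le_of_not_touchOnce ht hn hB hA hv hu (by omega)
      (fun F hF => ⟨hBr F hF, hBt F hF⟩) hAr).trans hconst
  obtain ⟨F₁, hF₁, hF₁'⟩ := hAt
  obtain ⟨G₁, hG₁, hG₁'⟩ := hBt
  obtain ⟨m₀, hFt⟩ := touchOnce_zero_iff.1 hF₁'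
  obtain ⟨m₁, hGt⟩ := touchOnce_zero_iff.1 hG₁'
  obtain rfl : m₁ = m₀ := by
    obtain ⟨m, hm⟩ := hdual F₁ hF₁ G₁ hG₁
    have h1 := hFt.two_mul_pre_le m
    have h2 := hGt.two_mul_pre_le m
    by_contra hne'
    by_cases hm0 : m = m₀
    · have := hGt.2 m (by omega)
      omega
    · have := hFt.2 m hm0
      omega
  have hA' : ∀ F ∈ A, Reach 0 (u + 1) F ∨ 2 * pre F m₁ = m₁ + u := by
    intro F hF
    by_cases hr : Reach 0 (u + 1) F
    · exact Or.inl hr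
    · obtain ⟨m, hm⟩ := hdual F hF G₁ hG₁
      have h1 := two_mul_pre_le hr m
      have h2 := hGt.two_mul_pre_le m
      by_cases hm0 : m = m₁
      · subst hm0; right; omega
      · have := hGt.2 m hm0
        omega
  have hB' : ∀ F ∈ B, Reach 0 (v + 1) F ∨ 2 * pre F m₁ = m₁ + v := by
    intro F hF
    by_cases hr : Reach 0 (v + 1) F
    · exact Or.inl hr
    · obtain ⟨m, hm⟩ := hdual F₁ hF₁ F hF
      have h1 := two_mul_pre_le hr m
      have h2 := hFt.two_mul_pre_le m
      by_cases hm0 : m = m₁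
      · subst hm0; right; omega
      · have := hFt.2 m hm0
        omega
  -- Both levels have the parity of the common time, so half-integers do not occur.
  obtain ⟨s, s', hm, hu', hv', h1, h2⟩ : ∃ s s', m₁ = t + s + s' ∧ u = t + s' - s ∧
      v = t + s - s' ∧ s ≤ t + s' ∧ s' ≤ t + s := by
    have h1 := pre_le F₁ m₁
    have h2 := pre_le G₁ m₁
    have h3 := hFt.1
    have h4 := hGt.1
    exact ⟨m₁ - pre F₁ m₁, m₁ - pre G₁ m₁, by omega, by omega, by omega, by omega, by omega⟩
  subst hm hu' hv'
  refine card_mul_card_le_of_touchAt ht hn hA hB hdual h1 h2 hu hv hAr hBr ⟨F₁, hF₁, hFt⟩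
    ⟨G₁, hG₁, hGt⟩ hA' hB' ?_
  rintro ⟨rfl, hs⟩
  rw [Nat.add_sub_cancel, add_assoc, ← two_mul] at hFt hGt
  exact hne s hs ⟨⟨F₁, hF₁, hFt⟩, G₁, hG₁, hGt⟩

/-! ### Stability and uniqueness -/

theorem sqrt_mul_le_half_add {a b : ℝ} (ha : 0 ≤ a) (hb : 0 ≤ b) : √(a * b) ≤ (a + b) / 2 := by
  rw [Real.sqrt_le_left (by positivity)]
  nlinarith [sq_nonneg (a - b)]

theorem card_symmDiff_eq_zero {A F : Finset (Finset ℕ)} (h : (symmDiff A F).card = 0) :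
    A = F := by
  rw [Finset.card_eq_zero] at h
  exact symmDiff_eq_bot.1 h

theorem card_eq_card_inter_add (A F : Finset (Finset ℕ)) :
    (A.card : ℝ) = (A ∩ F).card + (A \ F).card := by
  rw [add_comm]; exact_mod_cast (Finset.card_sdiff_add_card_inter A F).symm

theorem card_symmDiff_eq_inter (A F : Finset (Finset ℕ)) :
    ((symmDiff A F).card : ℝ) = (A \ F).card + (F.card - (A ∩ F).card) := by
  rw [card_symmDiff_eq, card_eq_card_inter_add F A, Finset.inter_comm F A]; ring

/-- If one of two families misses at least half of `F` and both together differ from `F` by less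
than the size of `F`, they are smaller than `F` on average. -/
theorem card_add_card_lt {A B F : Finset (Finset ℕ)}
    (hA : 2 * ((A ∩ F).card : ℝ) ≤ F.card)
    (hAB : ((symmDiff A F).card : ℝ) + (symmDiff B F).card < F.card) :
    (A.card : ℝ) + B.card < 2 * F.card := by
  rw [card_symmDiff_eq_inter, card_symmDiff_eq_inter] at hAB
  rw [card_eq_card_inter_add A F, card_eq_card_inter_add B F]
  have : ((B ∩ F).card : ℝ) ≤ F.card :=
    Nat.cast_le.2 (Finset.card_le_card Finset.inter_subset_right)
  linarith

theorem sqrt_le_card_frankl_of_close {t n k s : ℕ} {η : ℝ} (ht : 14 ≤ t)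
    (hn : (t + 1) * k ≤ n) (hs : s ≤ 1) (hη : η ≤ 1) {A B : Finset (Finset ℕ)}
    (hA : A ⊆ uniformSets n k) (hB : B ⊆ uniformSets n k)
    (hdual : ∀ F ∈ A, ∀ G ∈ B, ∃ m, m + t ≤ pre F m + pre G m)
    (hc : CloseToFrankl t s n k η A B) :
    √((A.card : ℝ) * B.card) ≤ (frankl t s n k).card ∧
      (√((A.card : ℝ) * B.card) = (frankl t s n k).card ↔
        A = frankl t s n k ∧ B = frankl t s n k) := by
  have hsq := sqrt_mul_le_half_add (a := (A.card : ℝ)) (b := B.card) (Nat.cast_nonneg _)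
    (Nat.cast_nonneg _)
  have hback : A = frankl t s n k ∧ B = frankl t s n k →
      √((A.card : ℝ) * B.card) = (frankl t s n k).card := by
    intro h
    rw [h.1, h.2, Real.sqrt_mul_self (Nat.cast_nonneg _)]
  have hclose : ((symmDiff A (frankl t s n k)).card : ℝ) + (symmDiff B (frankl t s n k)).card <
      (frankl t s n k).card :=
    lt_of_lt_of_le hc (mul_le_of_le_one_left (Nat.cast_nonneg _) hη)
  by_cases hT : (∃ F ∈ A, TouchAt (t + 2 * s) t F) ∧ ∃ G ∈ B, TouchAt (t + 2 * s) t G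
  · obtain ⟨h1, -⟩ := card_add_card_le_frankl ht hn hs hA hB hdual hT.1 hT.2
    have h2 : (0 : ℝ) ≤ (symmDiff A (frankl t s n k)).card := Nat.cast_nonneg _
    have h3 : (0 : ℝ) ≤ (symmDiff B (frankl t s n k)).card := Nat.cast_nonneg _
    refine ⟨by linarith, fun h => ?_, hback⟩
    exact ⟨card_symmDiff_eq_zero (by exact_mod_cast le_antisymm (by linarith) h2),
      card_symmDiff_eq_zero (by exact_mod_cast le_antisymm (by linarith) h3)⟩
  · have hlt : (A.card : ℝ) + B.card < 2 * (frankl t s n k).card := by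
      rcases not_and_or.1 hT with h | h
      · exact card_add_card_lt (two_mul_card_inter_frankl_le ht hn hs h) hclose
      · rw [add_comm]
        exact card_add_card_lt (two_mul_card_inter_frankl_le ht hn hs h) (by linarith)
    exact ⟨by linarith, fun h => absurd h (by linarith), hback⟩

theorem sqrt_lt_or_close {t n k : ℕ} {η : ℝ} (ht : 14 ≤ t)
    (hn : (t + 1) * k ≤ n) (hη0 : 0 < η) (hη : η ≤ 1) {A B : Finset (Finset ℕ)}
    (hA : A ⊆ uniformSets n k) (hB : B ⊆ uniformSets n k)
    (hdual : ∀ F ∈ A, ∀ G ∈ B, ∃ m, m + t ≤ pre F m + pre G m) :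
    √((A.card : ℝ) * B.card) <
        (1 - 1 / (100 * ((t : ℝ) + 1)) * η) * ((n - t).choose (k - t) : ℝ) ∨
      ∃ s : ℕ, (s = 0 ∨ s = 1) ∧ CloseToFrankl t s n k η A B := by
  have ht14 : (14 : ℝ) ≤ t := by exact_mod_cast ht
  have hM : (0 : ℝ) < ((n - t).choose (k - t) : ℝ) := by
    have hkn : k ≤ n := by nlinarith
    exact_mod_cast starCard_pos hkn t
  set M : ℝ := ((n - t).choose (k - t) : ℝ) with hMdef
  set γ : ℝ := 1 / (100 * ((t : ℝ) + 1)) with hγ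
  have hγ0 : 0 < γ := by positivity
  have hγ1 : γ ≤ 1 / 1500 := by
    rw [hγ]; gcongr; linarith
  have hγη : γ * η ≤ γ := mul_le_of_le_one_right hγ0.le hη
  rcases A.eq_empty_or_nonempty with rfl | hAne
  · left
    simp only [Finset.card_empty, Nat.cast_zero, zero_mul, Real.sqrt_zero]
    exact mul_pos (by linarith) hM
  rcases B.eq_empty_or_nonempty with rfl | hBne
  · left
    simp only [Finset.card_empty, Nat.cast_zero, mul_zero, Real.sqrt_zero]
    exact mul_pos (by linarith) hM
  by_cases hT : ∀ s ≤ 1,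
      ¬ ((∃ F ∈ A, TouchAt (t + 2 * s) t F) ∧ ∃ G ∈ B, TouchAt (t + 2 * s) t G)
  · -- `(1 - γ * η) ^ 2` exceeds `1 - 2 * γ`, and the constant `1 - 10 * γ` is below that.
    left
    have h := card_mul_card_le_of_not_touchAt ht hn hA hB hdual hAne hBne hT
    have hpos : 0 < (1 - γ * η) * M := mul_pos (by linarith) hM
    rw [Real.sqrt_lt' hpos]
    refine lt_of_le_of_lt h ?_
    rw [mul_pow]
    have h1 : 1 / (10 * ((t : ℝ) + 1)) = 10 * γ := by rw [hγ]; field_simp; norm_num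
    have hM2 : (0 : ℝ) < M ^ 2 := by positivity
    rw [h1]
    refine mul_lt_mul_of_pos_right ?_ hM2
    nlinarith
  · push Not at hT
    obtain ⟨s, hs, hTA, hTB⟩ := hT
    by_cases hc : CloseToFrankl t s n k η A B
    · exact Or.inr ⟨s, by omega, hc⟩
    left
    obtain ⟨h1, h2⟩ := card_add_card_le_frankl ht hn hs hA hB hdual hTA hTB
    have hts : t + s ≤ k := by
      obtain ⟨F, hF⟩ := Finset.card_pos.1 h2
      rw [frankl_eq] at hF
      obtain ⟨h3, h4⟩ := Finset.mem_filter.1 hF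
      have := pre_le_card F (t + 2 * s)
      rw [card_of_mem_uniformSets h3] at this
      omega
    have h3 : ((frankl t s n k).card : ℝ) ≤ M :=
      Nat.cast_le.2 (card_frankl_le (by omega) hn hs hts)
    have h2' : (0 : ℝ) < (frankl t s n k).card := by exact_mod_cast h2
    unfold CloseToFrankl at hc
    rw [not_lt] at hc
    have hsq := sqrt_mul_le_half_add (a := (A.card : ℝ)) (b := B.card) (Nat.cast_nonneg _)
      (Nat.cast_nonneg _)
    calc √((A.card : ℝ) * B.card) ≤ (1 - 1 / 10 * η) * (frankl t s n k).card := by linarith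
      _ < (1 - γ * η) * (frankl t s n k).card := by
          refine mul_lt_mul_of_pos_right ?_ h2'
          nlinarith
      _ ≤ (1 - γ * η) * M := by
          refine mul_le_mul_of_nonneg_left h3 ?_
          linarith

theorem mainTheorem6 (t : ℕ) (ht : 14 ≤ t) :
    ∃ γ : ℝ, 0 < γ ∧ γ ≤ 1 ∧
      ∀ (k n : ℕ) (η : ℝ) (A B : Finset (Finset ℕ)),
        t ≤ k → (t + 1) * k ≤ n → 0 < η → η ≤ 1 →
        A ⊆ uniformSets n k → B ⊆ uniformSets n k →
        IsShifted n A → IsShifted n B → CrossIntersecting t A B →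
        (Real.sqrt ((A.card : ℝ) * (B.card : ℝ)) < (1 - γ * η) * ((n - t).choose (k - t) : ℝ) ∨
          ∃ s : ℕ, (s = 0 ∨ s = 1) ∧ CloseToFrankl t s n k η A B) ∧
        ∀ s : ℕ, (s = 0 ∨ s = 1) → CloseToFrankl t s n k η A B →
          Real.sqrt ((A.card : ℝ) * (B.card : ℝ)) ≤ ((frankl t s n k).card : ℝ) ∧
          (Real.sqrt ((A.card : ℝ) * (B.card : ℝ)) = ((frankl t s n k).card : ℝ) ↔
            A = frankl t s n k ∧ B = frankl t s n k) := by
  refine ⟨1 / (100 * ((t : ℝ) + 1)), by positivity, ?_, ?_⟩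
  · rw [div_le_one (by positivity)]
    have : (0 : ℝ) ≤ t := Nat.cast_nonneg t
    linarith
  · intro k n η A B _ hn hη0 hη hA hB hsA _ hAB
    have hdual : ∀ F ∈ A, ∀ G ∈ B, ∃ m, m + t ≤ pre F m + pre G m := fun F hF G hG =>
      exists_pre_add_pre_ge (by omega) hA hsA hAB hF hG
    exact ⟨sqrt_lt_or_close ht hn hη0 hη hA hB hdual, fun s hs hc =>
      sqrt_le_card_frankl_of_close ht hn (by omega) hη hA hB hdual hc⟩
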